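/- **Conventions.** All manifolds and maps are smooth. A Lie groupoid $\mathscr G\rightrightarrows M$ has source $s$, target $t$ (surjective submersions), units $\mathrm{Id}_m$, inversion, and a product $g.h$ defined when $s(g)=t(h)$. A *bisection* is a smooth section $\beta\colon M\to\mathscr G$ of $s$ such that $t_*\beta:=t\circ\beta$ is a diffeomorphism of $M$. Bisections form a group $\mathbb B=\mathrm{Bisec}(\mathscr G)$ under $(\beta_2\cdot\beta_1)(m)=\beta_2(t(\beta_1(m))).\beta_1(m)$. It acts on $\mathscr G$ from the left by $\beta\vartriangleright g=\beta(t(g)).g$ and from the right by $g\vartriangleleft\beta=g.(\beta^{-1}(s(g)))^{-1}$. The pair groupoid $\mathrm{Pair}(\Sigma)$ has arrows $\Sigma\times\Sigma$, where $(x,y)$ has source $y$ and target $x$. **Principaloid bundles.** A principaloid $\mathscr G$-bundle over $\Sigma$ is a manifold $\mathscr P$ with a surjective submersion $\pi_{\mathscr P}\colon\mathscr P\to\Sigma$ and a smooth right $\mathscr G$-action $(p,g)\mapsto p\blacktriangleleft g$, defined when $\mu(p)=t(g)$ for a moment map $\mu\colon\mathscr P\to M$. The action preserves the fibres of $\pi_{\mathscr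 P}$. Moreover $\Sigma$ is covered by open sets $O_i$ with diffeomorphisms $\tau_i\colon\pi_{\mathscr P}^{-1}(O_i)\to O_i\times\mathscr G$ over $O_i$ which are equivariant: $\mu(\tau_i^{-1}(\sigma,g))=s(g)$ and $\tau_i^{-1}(\sigma,g)\blacktriangleleft h=\tau_i^{-1}(\sigma,g.h)$. Then $\tau_i\circ\tau_j^{-1}(\sigma,g)=(\sigma,\beta_{ij}(\sigma)\vartriangleright g)$ for unique bisections $\beta_{ij}(\sigma)\in\mathbb B$, $\sigma\in O_i\cap O_j$. $\mathrm{Aut}(\mathscr P)$ is the group (under composition) of diffeomorphisms $\Phi$ of $\mathscr P$ which are $\mathscr G$-equivariant ($\mu\circ\Phi=\mu$ and $\Phi(p\blacktriangleleft g)=\Phi(p)\blacktriangleleft g$) and cover a diffeomorphism $f$ of $\Sigma$ ($\pi_{\mathscr P}\circ\Phi=f\circ\pi_{\mathscr P}$). $\mathrm{Gauge}(\mathscr P)$ is the subgroup of those with $f=\mathrm{id}_\Sigma$. **The Atiyah–Ehresmann groupoid.** Fix a trivializing cover $(O_i,\tau_i)$ as above. The shadow bundle is $$\pi_{\mathscr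 F}\colon\mathscr F=\bigsqcup_i(O_i\times M)/\!\sim\ \to\Sigma,\qquad (\sigma,m,j)\sim(\sigma,t_*(\beta_{ij}(\sigma))(m),i).$$ The arrow manifold is $$\mathrm{At}(\mathscr P)=\bigsqcup_{i,j}(O_i\times\mathscr G\times O_j)/\!\sim,\qquad (\sigma_1,g,\sigma_2,k,l)\sim(\sigma_1,\beta_{ik}(\sigma_1)\vartriangleright g\vartriangleleft\beta_{lj}(\sigma_2),\sigma_2,i,j).$$ $\mathrm{At}(\mathscr P)\rightrightarrows\mathscr F$ is the Lie groupoid with source $[(\sigma_1,g,\sigma_2,i,j)]\mapsto[(\sigma_2,s(g),j)]$, target $[(\sigma_1,g,\sigma_2,i,j)]\mapsto[(\sigma_1,t(g),i)]$, units $[(\sigma,m,i)]\mapsto[(\sigma,\mathrm{Id}_m,\sigma,i,i)]$, inverse $[(\sigma_1,g,\sigma_2,i,j)]\mapsto[(\sigma_2,g^{-1},\sigma_1,j,i)]$ and product $[(\sigma_1,g,\sigma_2,i,j)].[(\sigma_2,h,\sigma_3,j,l)]=[(\sigma_1,g.h,\sigma_3,i,l)]$. Let $\pi\colon\mathrm{At}(\mathscr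 P)\to\Sigma\times\Sigma$, $[(\sigma_1,g,\sigma_2,i,j)]\mapsto(\sigma_1,\sigma_2)$, and $\mathrm{Ad}(\mathscr P)=\pi^{-1}(\text{diagonal})$. A bisection $\beta$ of $\mathrm{At}(\mathscr P)\rightrightarrows\mathscr F$ is *$\pi$-projectable* if $\pi\circ\beta=\underline\beta\circ\pi_{\mathscr F}$ for some bisection $\underline\beta$ of $\mathrm{Pair}(\Sigma)$. These form a subgroup $\mathrm{Bisec}_\pi(\mathrm{At}(\mathscr P))\subset\mathrm{Bisec}(\mathrm{At}(\mathscr P))$. Its subgroup $\mathrm{Bisec}_\pi(\mathrm{Ad}(\mathscr P))$ consists of those with $\underline\beta$ the identity bisection, i.e. $\pi\circ\beta=(\pi_{\mathscr F},\pi_{\mathscr F})$. **Theorem.** Let $\mathscr P$ be a principaloid $\mathscr G$-bundle over $\Sigma$, with any trivializing cover. There is a group isomorphism $$\Psi\colon\mathrm{Bisec}_\pi(\mathrm{At}(\mathscr P))\xrightarrow{\ \cong\ }\mathrm{Aut}(\mathscr P)$$ which is canonical in the sense that it is given by the following formula. Let $\Phi\in\mathrm{Aut}(\mathscr P)$ cover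 $f$. For all $i,j$ and all $\sigma\in O_i\cap f^{-1}(O_j)$ there is a bisection $\gamma_{(j,i)}(\sigma)\in\mathbb B$ such that $$\Phi(\tau_i^{-1}(\sigma,g))=\tau_j^{-1}\bigl(f(\sigma),\gamma_{(j,i)}(\sigma)\vartriangleright g\bigr)\ \text{ for all } g\in\mathscr G,$$ $$\Psi^{-1}(\Phi)\bigl([(\sigma,m,i)]\bigr)=[(f(\sigma),\gamma_{(j,i)}(\sigma)(m),\sigma,j,i)]\ \text{ for all } m\in M.$$ Moreover $\Psi$ restricts to a group isomorphism $\mathrm{Bisec}_\pi(\mathrm{Ad}(\mathscr P))\cong\mathrm{Gauge}(\mathscr P)$. -/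

import Mathlib

open Set Bundle Topology
open scoped Manifold ContDiff

noncomputable section

namespace Principaloid

/-! ### Lie groupoids -/

section LieGroupoids

variable {EM HM EG HG : Type*} [NormedAddCommGroup EM] [NormedSpace ℝ EM] [TopologicalSpace HM]
  [NormedAddCommGroup EG] [NormedSpace ℝ EG] [TopologicalSpace HG]

/-- A Lie groupoid with object manifold `M` and arrow manifold `G`. Arrows compose like maps:
`mul g h` is meaningful when `src g = trg h` (the values of `mul` on other pairs are irrelevant).
The source and target maps are surjective (because of `unit`) submersions. -/
structure LieGroupoid (I : ModelWithCorners ℝ EM HM) (J : ModelWithCorners ℝ EG HG)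
    (M G : Type*) [TopologicalSpace M] [ChartedSpace HM M] [IsManifold I ∞ M]
    [TopologicalSpace G] [ChartedSpace HG G] [IsManifold J ∞ G] where
  /-- source -/
  src : G → M
  /-- target -/
  trg : G → M
  /-- the identity arrow at an object -/
  unit : M → G
  /-- inversion of arrows -/
  inv : G → G
  /-- composition of arrows -/
  mul : G → G → G
  src_unit : ∀ m, src (unit m) = m
  trg_unit : ∀ m, trg (unit m) = m
  src_inv : ∀ g, src (inv g) = trg g
  trg_inv : ∀ g, trg (inv g) = src g
  src_mul : ∀ g h, src g = trg h → src (mul g h) = src h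
  trg_mul : ∀ g h, src g = trg h → trg (mul g h) = trg g
  mul_assoc : ∀ g h k, src g = trg h → src h = trg k → mul (mul g h) k = mul g (mul h k)
  unit_mul : ∀ g, mul (unit (trg g)) g = g
  mul_unit : ∀ g, mul g (unit (src g)) = g
  inv_mul : ∀ g, mul (inv g) g = unit (src g)
  mul_inv : ∀ g, mul g (inv g) = unit (trg g)
  isSubmersion_src : Manifold.IsSubmersion J I ∞ src
  isSubmersion_trg : Manifold.IsSubmersion J I ∞ trg
  contMDiff_unit : ContMDiff I J ∞ unit
  contMDiff_inv : ContMDiff J J ∞ inv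
  /-- composition is smooth on the manifold of composable pairs -/
  contMDiffOn_mul :
    ContMDiffOn (J.prod J) J ∞ (fun p : G × G => mul p.1 p.2) {p | src p.1 = trg p.2}

variable {I : ModelWithCorners ℝ EM HM} {J : ModelWithCorners ℝ EG HG}
  {M G : Type*} [TopologicalSpace M] [ChartedSpace HM M] [IsManifold I ∞ M]
  [TopologicalSpace G] [ChartedSpace HG G] [IsManifold J ∞ G]

namespace LieGroupoid

variable (𝒢 : LieGroupoid I J M G)

theorem src_surjective : Function.Surjective 𝒢.src := fun m => ⟨𝒢.unit m, 𝒢.src_unit m⟩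

theorem trg_surjective : Function.Surjective 𝒢.trg := fun m => ⟨𝒢.unit m, 𝒢.trg_unit m⟩

theorem contMDiff_src : ContMDiff J I ∞ 𝒢.src := 𝒢.isSubmersion_src.contMDiff

theorem contMDiff_trg : ContMDiff J I ∞ 𝒢.trg := 𝒢.isSubmersion_trg.contMDiff

theorem inv_mul_cancel_left {g h : G} (e : 𝒢.src g = 𝒢.trg h) :
    𝒢.mul (𝒢.inv g) (𝒢.mul g h) = h := by
  rw [← 𝒢.mul_assoc _ _ _ (𝒢.src_inv g) e, 𝒢.inv_mul, e, 𝒢.unit_mul]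

theorem mul_inv_cancel_left {g h : G} (e : 𝒢.trg g = 𝒢.trg h) :
    𝒢.mul g (𝒢.mul (𝒢.inv g) h) = h := by
  rw [← 𝒢.mul_assoc _ _ _ (𝒢.trg_inv g).symm ((𝒢.src_inv g).trans e), 𝒢.mul_inv, e, 𝒢.unit_mul]

theorem mul_inv_cancel_right {g h : G} (e : 𝒢.src g = 𝒢.trg h) :
    𝒢.mul (𝒢.mul g h) (𝒢.inv h) = g := by
  rw [𝒢.mul_assoc _ _ _ e (𝒢.trg_inv h).symm, 𝒢.mul_inv, ← e, 𝒢.mul_unit]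

theorem inv_eq_of_mul_eq_unit {g h : G} (e : 𝒢.src g = 𝒢.trg h)
    (hu : 𝒢.mul g h = 𝒢.unit (𝒢.src h)) : g = 𝒢.inv h := by
  have := 𝒢.mul_inv_cancel_right e
  rw [hu, ← 𝒢.trg_inv h, 𝒢.unit_mul] at this
  exact this.symm

theorem inv_inv (g : G) : 𝒢.inv (𝒢.inv g) = g :=
  (𝒢.inv_eq_of_mul_eq_unit (𝒢.trg_inv g).symm (by rw [𝒢.mul_inv, 𝒢.src_inv])).symm

theorem inv_unit (m : M) : 𝒢.inv (𝒢.unit m) = 𝒢.unit m := by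
  refine (𝒢.inv_eq_of_mul_eq_unit (by rw [𝒢.src_unit, 𝒢.trg_unit]) ?_).symm
  have := 𝒢.mul_unit (𝒢.unit m)
  rw [𝒢.src_unit] at this
  rw [this, 𝒢.src_unit]

theorem inv_mul_rev {g h : G} (e : 𝒢.src g = 𝒢.trg h) :
    𝒢.inv (𝒢.mul g h) = 𝒢.mul (𝒢.inv h) (𝒢.inv g) := by
  have e' : 𝒢.src (𝒢.inv h) = 𝒢.trg (𝒢.inv g) := by rw [𝒢.src_inv, 𝒢.trg_inv, e]
  refine (𝒢.inv_eq_of_mul_eq_unit (by rw [𝒢.src_mul _ _ e', 𝒢.src_inv, 𝒢.trg_mul _ _ e]) ?_).symm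
  rw [𝒢.mul_assoc _ _ _ e' (by rw [𝒢.src_inv, 𝒢.trg_mul _ _ e]), 𝒢.inv_mul_cancel_left e,
    𝒢.inv_mul, 𝒢.src_mul _ _ e]

end LieGroupoid

/-! ### The group of bisections -/

/-- A (global) bisection: a smooth section of the source map whose composition with the target
map is a diffeomorphism of the object manifold. -/
structure Bisection (𝒢 : LieGroupoid I J M G) where
  toFun : M → G
  contMDiff_toFun : ContMDiff I J ∞ toFun
  src_toFun : ∀ m, 𝒢.src (toFun m) = m
  exists_diffeomorph : ∃ d : Diffeomorph I I M M ∞, ∀ m, d m = 𝒢.trg (toFun m)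

namespace Bisection

variable {𝒢 : LieGroupoid I J M G}

instance : CoeFun (Bisection 𝒢) (fun _ => M → G) := ⟨Bisection.toFun⟩

theorem ext_fun {β γ : Bisection 𝒢} (h : ∀ m, β m = γ m) : β = γ := by
  cases β; cases γ; congr; exact funext h

theorem src_apply (β : Bisection 𝒢) (m : M) : 𝒢.src (β m) = m := β.src_toFun m

/-- The shadow of a bisection: the diffeomorphism `trg ∘ β` of the object manifold. -/
def shadow (β : Bisection 𝒢) : Diffeomorph I I M M ∞ := β.exists_diffeomorph.choose

theorem shadow_apply (β : Bisection 𝒢) (m : M) : β.shadow m = 𝒢.trg (β m) :=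
  β.exists_diffeomorph.choose_spec m

theorem trg_symm_apply (β : Bisection 𝒢) (m : M) : 𝒢.trg (β (β.shadow.symm m)) = m := by
  rw [← shadow_apply, Diffeomorph.apply_symm_apply]

/-- The product of bisections, `(β₂ · β₁)(m) = β₂(t(β₁(m))) . β₁(m)`. -/
instance : Mul (Bisection 𝒢) where
  mul β₂ β₁ :=
    { toFun := fun m => 𝒢.mul (β₂ (𝒢.trg (β₁ m))) (β₁ m)
      contMDiff_toFun := by
        have h : ContMDiff I (J.prod J) ∞ (fun m => (β₂ (𝒢.trg (β₁ m)), β₁ m)) :=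
          (β₂.contMDiff_toFun.comp (𝒢.contMDiff_trg.comp β₁.contMDiff_toFun)).prodMk
            β₁.contMDiff_toFun
        rw [← contMDiffOn_univ] at h ⊢
        exact 𝒢.contMDiffOn_mul.comp h (fun m _ => β₂.src_apply _)
      src_toFun := fun m => by rw [𝒢.src_mul _ _ (β₂.src_apply _), β₁.src_apply]
      exists_diffeomorph := ⟨β₁.shadow.trans β₂.shadow, fun m => by
        rw [𝒢.trg_mul _ _ (β₂.src_apply _), Diffeomorph.coe_trans, Function.comp_apply,
          shadow_apply, shadow_apply]⟩ }

/-- The unit bisection. -/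
instance : One (Bisection 𝒢) where
  one :=
    { toFun := 𝒢.unit
      contMDiff_toFun := 𝒢.contMDiff_unit
      src_toFun := 𝒢.src_unit
      exists_diffeomorph := ⟨Diffeomorph.refl I M ∞, fun m => (𝒢.trg_unit m).symm⟩ }

/-- The inverse of a bisection, `β⁻¹(m) = (β((t ∘ β)⁻¹(m)))⁻¹`. -/
instance : Inv (Bisection 𝒢) where
  inv β :=
    { toFun := fun m => 𝒢.inv (β (β.shadow.symm m))
      contMDiff_toFun :=
        𝒢.contMDiff_inv.comp (β.contMDiff_toFun.comp β.shadow.symm.contMDiff)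
      src_toFun := fun m => by rw [𝒢.src_inv, trg_symm_apply]
      exists_diffeomorph := ⟨β.shadow.symm, fun m => by rw [𝒢.trg_inv, src_apply]⟩ }

theorem mul_apply (β₂ β₁ : Bisection 𝒢) (m : M) :
    (β₂ * β₁) m = 𝒢.mul (β₂ (𝒢.trg (β₁ m))) (β₁ m) := rfl

theorem one_apply (m : M) : (1 : Bisection 𝒢) m = 𝒢.unit m := rfl

theorem inv_apply (β : Bisection 𝒢) (m : M) : β⁻¹ m = 𝒢.inv (β (β.shadow.symm m)) := rfl

/-- The group of bisections. -/
instance : Group (Bisection 𝒢) where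
  mul_assoc β₃ β₂ β₁ := ext_fun fun m => by
    simp only [mul_apply]
    rw [𝒢.mul_assoc _ _ _ (by rw [src_apply]) (by rw [src_apply]),
      𝒢.trg_mul _ _ (src_apply _ _)]
  one_mul β := ext_fun fun m => by rw [mul_apply, one_apply, 𝒢.unit_mul]
  mul_one β := ext_fun fun m => by
    have := 𝒢.mul_unit (β m)
    rw [src_apply] at this
    rw [mul_apply, one_apply, 𝒢.trg_unit, this]
  inv_mul_cancel β := ext_fun fun m => by
    rw [mul_apply, inv_apply, ← shadow_apply, Diffeomorph.symm_apply_apply, 𝒢.inv_mul, src_apply,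
      one_apply]

/-- Left multiplication of arrows by bisections, `β ▷ g = β(t(g)) . g`. -/
def leftMul (β : Bisection 𝒢) (g : G) : G := 𝒢.mul (β (𝒢.trg g)) g

/-- Right multiplication of arrows by bisections, `g ◁ β = g . (β⁻¹(s(g)))⁻¹`. -/
def rightMul (g : G) (β : Bisection 𝒢) : G := 𝒢.mul g (𝒢.inv (β⁻¹ (𝒢.src g)))

theorem src_leftMul (β : Bisection 𝒢) (g : G) : 𝒢.src (β.leftMul g) = 𝒢.src g :=
  𝒢.src_mul _ _ (β.src_apply _)

theorem trg_leftMul (β : Bisection 𝒢) (g : G) : 𝒢.trg (β.leftMul g) = β.shadow (𝒢.trg g) := by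
  rw [leftMul, 𝒢.trg_mul _ _ (β.src_apply _), shadow_apply]

theorem src_eq_trg_inv_inv (β : Bisection 𝒢) (m : M) : m = 𝒢.trg (𝒢.inv (β⁻¹ m)) := by
  rw [𝒢.trg_inv, src_apply]

theorem src_rightMul (g : G) (β : Bisection 𝒢) :
    𝒢.src (rightMul g β) = (β⁻¹).shadow (𝒢.src g) := by
  rw [rightMul, 𝒢.src_mul _ _ (src_eq_trg_inv_inv β _), 𝒢.src_inv, shadow_apply]

theorem trg_rightMul (g : G) (β : Bisection 𝒢) : 𝒢.trg (rightMul g β) = 𝒢.trg g :=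
  𝒢.trg_mul _ _ (src_eq_trg_inv_inv β _)

theorem shadow_mul (β₂ β₁ : Bisection 𝒢) (m : M) :
    (β₂ * β₁).shadow m = β₂.shadow (β₁.shadow m) := by
  rw [shadow_apply, mul_apply, 𝒢.trg_mul _ _ (β₂.src_apply _), shadow_apply, shadow_apply]

theorem shadow_one (m : M) : (1 : Bisection 𝒢).shadow m = m := by
  rw [shadow_apply, one_apply, 𝒢.trg_unit]

theorem mul_leftMul (β₂ β₁ : Bisection 𝒢) (g : G) :
    (β₂ * β₁).leftMul g = β₂.leftMul (β₁.leftMul g) := by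
  simp only [leftMul, mul_apply]
  rw [𝒢.mul_assoc _ _ _ (by rw [src_apply]) (by rw [src_apply]),
    𝒢.trg_mul _ _ (src_apply _ _)]

theorem one_leftMul (g : G) : (1 : Bisection 𝒢).leftMul g = g := 𝒢.unit_mul g

theorem inv_leftMul_inv (β : Bisection 𝒢) (g : G) :
    𝒢.inv (β⁻¹.leftMul (𝒢.inv g)) = rightMul g β := by
  rw [leftMul, 𝒢.inv_mul_rev (src_apply _ _), 𝒢.inv_inv, rightMul, 𝒢.trg_inv]

theorem inv_rightMul (g : G) (β : Bisection 𝒢) :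
    𝒢.inv (rightMul g β) = β⁻¹.leftMul (𝒢.inv g) := by
  rw [← inv_leftMul_inv, 𝒢.inv_inv]

theorem rightMul_mul (g : G) (β γ : Bisection 𝒢) :
    rightMul g (β * γ) = rightMul (rightMul g β) γ := by
  rw [← inv_leftMul_inv, ← inv_leftMul_inv, ← inv_leftMul_inv, 𝒢.inv_inv, mul_inv_rev, mul_leftMul]

theorem rightMul_one (g : G) : rightMul g (1 : Bisection 𝒢) = g := by
  rw [← inv_leftMul_inv, inv_one, one_leftMul, 𝒢.inv_inv]

theorem leftMul_rightMul (β γ : Bisection 𝒢) (g : G) :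
    β.leftMul (rightMul g γ) = rightMul (β.leftMul g) γ := by
  rw [leftMul, trg_rightMul, rightMul, rightMul, src_leftMul, leftMul,
    𝒢.mul_assoc _ _ _ (src_apply _ _) (src_eq_trg_inv_inv γ _)]

theorem inv_leftMul (β : Bisection 𝒢) (g : G) :
    𝒢.inv (β.leftMul g) = rightMul (𝒢.inv g) β⁻¹ := by
  rw [← inv_leftMul_inv, _root_.inv_inv, 𝒢.inv_inv]

theorem leftMul_unit (β : Bisection 𝒢) (m : M) : β.leftMul (𝒢.unit m) = β m := by
  have := 𝒢.mul_unit (β m)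
  rw [src_apply] at this
  rw [leftMul, 𝒢.trg_unit, this]

theorem leftMul_rightMul_unit (β : Bisection 𝒢) (m : M) :
    β.leftMul (rightMul (𝒢.unit m) β⁻¹) = 𝒢.unit (β.shadow m) := by
  rw [← 𝒢.inv_unit, ← inv_leftMul, leftMul_unit, leftMul, 𝒢.trg_inv, src_apply, 𝒢.mul_inv,
    shadow_apply]

theorem leftMul_mul (β : Bisection 𝒢) {g h : G} (e : 𝒢.src g = 𝒢.trg h) :
    β.leftMul (𝒢.mul g h) = 𝒢.mul (β.leftMul g) h := by
  rw [leftMul, leftMul, 𝒢.trg_mul _ _ e, 𝒢.mul_assoc _ _ _ (src_apply _ _) e]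

theorem mul_rightMul (β : Bisection 𝒢) {g h : G} (e : 𝒢.src g = 𝒢.trg h) :
    𝒢.mul g (rightMul h β) = rightMul (𝒢.mul g h) β := by
  rw [rightMul, rightMul, 𝒢.src_mul _ _ e, 𝒢.mul_assoc _ _ _ e (src_eq_trg_inv_inv β _)]

theorem rightMul_mul_leftMul (β : Bisection 𝒢) {g h : G} (e : 𝒢.src g = 𝒢.trg h) :
    𝒢.mul (rightMul g β) (β⁻¹.leftMul h) = 𝒢.mul g h := by
  have e1 : 𝒢.src (β⁻¹ (𝒢.trg h)) = 𝒢.trg h := src_apply _ _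
  have e2 : 𝒢.src (𝒢.inv (β⁻¹ (𝒢.trg h))) = 𝒢.trg (𝒢.mul (β⁻¹ (𝒢.trg h)) h) := by
    rw [𝒢.src_inv, 𝒢.trg_mul _ _ e1]
  rw [rightMul, leftMul, e,
    𝒢.mul_assoc _ _ _ (by rw [𝒢.trg_inv, e1, e]) e2, 𝒢.inv_mul_cancel_left e1]

end Bisection

end LieGroupoids

/-! ### The pair groupoid -/

section Submersions

variable {E₁ E₂ H₁ H₂ : Type*} [NormedAddCommGroup E₁] [NormedSpace ℝ E₁] [TopologicalSpace H₁]
  [NormedAddCommGroup E₂] [NormedSpace ℝ E₂] [TopologicalSpace H₂]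
  (I₁ : ModelWithCorners ℝ E₁ H₁) (I₂ : ModelWithCorners ℝ E₂ H₂) (M₁ M₂ : Type*)
  [TopologicalSpace M₁] [ChartedSpace H₁ M₁] [IsManifold I₁ ∞ M₁]
  [TopologicalSpace M₂] [ChartedSpace H₂ M₂] [IsManifold I₂ ∞ M₂]

theorem isSubmersion_fst :
    Manifold.IsSubmersion (I₁.prod I₂) I₁ ∞ (Prod.fst : M₁ × M₂ → M₁) := by
  refine Manifold.IsSubmersionOfComplement.isSubmersion (F := E₂) fun x => ?_
  refine Manifold.IsSubmersionAtOfComplement.mk_of_charts (ContinuousLinearEquiv.refl ℝ _)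
    (chartAt _ x) (chartAt _ x.1) (mem_chart_source _ x) (mem_chart_source _ x.1)
    (IsManifold.chart_mem_maximalAtlas x) (IsManifold.chart_mem_maximalAtlas x.1) ?_ ?_
  · intro y hy
    exact hy.1
  · rintro ⟨u, v⟩ hy
    have hu : u ∈ ((chartAt H₁ x.1).extend I₁).target := by
      have := hy
      rw [prodChartedSpace_chartAt, OpenPartialHomeomorph.extend_prod] at this
      exact this.1
    simp only [Function.comp, prodChartedSpace_chartAt]
    exact ((chartAt H₁ x.1).extend I₁).right_inv hu

theorem isSubmersion_snd :
    Manifold.IsSubmersion (I₁.prod I₂) I₂ ∞ (Prod.snd : M₁ × M₂ → M₂) := by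
  refine Manifold.IsSubmersionOfComplement.isSubmersion (F := E₁) fun x => ?_
  refine Manifold.IsSubmersionAtOfComplement.mk_of_charts (ContinuousLinearEquiv.prodComm ℝ _ _)
    (chartAt _ x) (chartAt _ x.2) (mem_chart_source _ x) (mem_chart_source _ x.2)
    (IsManifold.chart_mem_maximalAtlas x) (IsManifold.chart_mem_maximalAtlas x.2) ?_ ?_
  · intro y hy
    exact hy.2
  · rintro ⟨u, v⟩ hy
    have hv : v ∈ ((chartAt H₂ x.2).extend I₂).target := by
      have := hy
      rw [prodChartedSpace_chartAt, OpenPartialHomeomorph.extend_prod] at this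
      exact this.2
    simp only [Function.comp, prodChartedSpace_chartAt]
    exact ((chartAt H₂ x.2).extend I₂).right_inv hv

/-- The pair groupoid of a manifold: the arrow `(x, y)` has source `y` and target `x`. -/
def pairGroupoid : LieGroupoid I₁ (I₁.prod I₁) M₁ (M₁ × M₁) where
  src := Prod.snd
  trg := Prod.fst
  unit x := (x, x)
  inv p := (p.2, p.1)
  mul p q := (p.1, q.2)
  src_unit _ := rfl
  trg_unit _ := rfl
  src_inv _ := rfl
  trg_inv _ := rfl
  src_mul _ _ _ := rfl
  trg_mul _ _ _ := rfl
  mul_assoc _ _ _ _ _ := rfl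
  unit_mul _ := rfl
  mul_unit _ := rfl
  inv_mul _ := rfl
  mul_inv _ := rfl
  isSubmersion_src := isSubmersion_snd I₁ I₁ M₁ M₁
  isSubmersion_trg := isSubmersion_fst I₁ I₁ M₁ M₁
  contMDiff_unit := contMDiff_id.prodMk contMDiff_id
  contMDiff_inv := contMDiff_snd.prodMk contMDiff_fst
  contMDiffOn_mul :=
    ((contMDiff_fst.comp contMDiff_fst).prodMk (contMDiff_snd.comp contMDiff_snd)).contMDiffOn

end Submersions

/-! ### Clutching: the manifold glued from a smooth cocycle -/

section Glued

variable {EB HB EF HF : Type*} [NormedAddCommGroup EB] [NormedSpace ℝ EB] [TopologicalSpace HB]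
  [NormedAddCommGroup EF] [NormedSpace ℝ EF] [TopologicalSpace HF]
  (IB : ModelWithCorners ℝ EB HB) (IF : ModelWithCorners ℝ EF HF)
  {ι B F : Type*} [TopologicalSpace B] [ChartedSpace HB B]
  [TopologicalSpace F] [ChartedSpace HF F]

/-- The coordinate changes of a fibre bundle core are smooth maps `(Uᵢ ∩ Uⱼ) × F → F`. -/
class SmoothCore (Z : FiberBundleCore ι B F) : Prop where
  smooth : ∀ i j, ContMDiffOn (IB.prod IF) IF ∞ (fun p : B × F => Z.coordChange i j p.1 p.2)
    ((Z.baseSet i ∩ Z.baseSet j) ×ˢ univ)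

/-- The total space of the bundle glued from a cocycle: the disjoint union of the `Uᵢ × F` modulo
`(x, v, i) ∼ (x, coordChange i j x v, j)`. The class of `(x, v, i)` is
`(Glued.triv Z i).symm (x, v)`. -/
def Glued (Z : FiberBundleCore ι B F) : Type _ := Z.TotalSpace

namespace Glued

variable (Z : FiberBundleCore ι B F)

instance : TopologicalSpace (Glued Z) := inferInstanceAs (TopologicalSpace Z.TotalSpace)

/-- The base projection of the glued bundle. -/
def proj : Glued Z → B := fun x => Bundle.TotalSpace.proj (E := Z.Fiber) x

/-- The local trivialization over `Uᵢ` of the glued bundle. -/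
def triv (i : ι) : Trivialization F (proj Z) := Z.localTriv i

instance : ChartedSpace (B × F) (Glued Z) where
  atlas := range fun i => (triv Z i).toOpenPartialHomeomorph
  chartAt x := (triv Z (Z.indexAt (proj Z x))).toOpenPartialHomeomorph
  mem_chart_source x := Z.mem_baseSet_at (proj Z x)
  chart_mem_atlas _ := ⟨_, rfl⟩

/-- The charts of the glued manifold are composed of local trivializations and charts of
`B × F`. -/
instance : ChartedSpace (ModelProd HB HF) (Glued Z) :=
  ChartedSpace.comp (ModelProd HB HF) (B × F) (Glued Z)

variable {Z}

theorem mem_triv_source {i : ι} {x : Glued Z} : x ∈ (triv Z i).source ↔ proj Z x ∈ Z.baseSet i :=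
  Iff.rfl

theorem mem_triv_target {i : ι} {y : B × F} : y ∈ (triv Z i).target ↔ y.1 ∈ Z.baseSet i :=
  (triv Z i).mem_target

/-- The gluing relation. -/
theorem triv_triv_symm {i j : ι} {x : B} (hi : x ∈ Z.baseSet i) (hj : x ∈ Z.baseSet j) (v : F) :
    triv Z j ((triv Z i).toOpenPartialHomeomorph.symm (x, v)) = (x, Z.coordChange i j x v) := by
  change ((x, Z.coordChange (Z.indexAt x) j x (Z.coordChange i (Z.indexAt x) x v)) : B × F) = _
  rw [Z.coordChange_comp _ _ _ _ ⟨⟨hi, Z.mem_baseSet_at x⟩, hj⟩]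

theorem triv_symm_eq {i j : ι} {x : B} (hi : x ∈ Z.baseSet i) (hj : x ∈ Z.baseSet j) (v : F) :
    (triv Z i).toOpenPartialHomeomorph.symm (x, v) =
      (triv Z j).toOpenPartialHomeomorph.symm (x, Z.coordChange i j x v) := by
  rw [← triv_triv_symm hi hj]
  refine ((triv Z j).toOpenPartialHomeomorph.left_inv ?_).symm
  exact hj

theorem contMDiffOn_trivChange [h : SmoothCore IB IF Z] (i j : ι) :
    ContMDiffOn (IB.prod IF) (IB.prod IF) ∞
      ((triv Z i).toOpenPartialHomeomorph.symm ≫ₕ (triv Z j).toOpenPartialHomeomorph)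
      ((triv Z i).toOpenPartialHomeomorph.symm ≫ₕ (triv Z j).toOpenPartialHomeomorph).source := by
  have hs : ∀ y ∈ ((triv Z i).toOpenPartialHomeomorph.symm ≫ₕ
      (triv Z j).toOpenPartialHomeomorph).source, y.1 ∈ Z.baseSet i ∧ y.1 ∈ Z.baseSet j := by
    intro y hy
    exact ⟨mem_triv_target.1 hy.1, hy.2⟩
  have h2 := (h.smooth i j).mono (t := ((triv Z i).toOpenPartialHomeomorph.symm ≫ₕ
      (triv Z j).toOpenPartialHomeomorph).source) (fun y hy => ⟨hs y hy, trivial⟩)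
  refine (contMDiffOn_fst.prodMk h2).congr fun y hy => ?_
  exact triv_triv_symm (hs y hy).1 (hs y hy).2 y.2

theorem contDiffOn_transition [SmoothCore IB IF Z] (i j : ι)
    {f f' : OpenPartialHomeomorph (B × F) (ModelProd HB HF)}
    (hf : f ∈ IsManifold.maximalAtlas (IB.prod IF) ∞ (B × F))
    (hf' : f' ∈ IsManifold.maximalAtlas (IB.prod IF) ∞ (B × F)) :
    ContDiffOn ℝ ∞ ((IB.prod IF) ∘ ((triv Z i).toOpenPartialHomeomorph ≫ₕ f).symm ≫ₕ
        ((triv Z j).toOpenPartialHomeomorph ≫ₕ f') ∘ (IB.prod IF).symm)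
      ((IB.prod IF).symm ⁻¹' (((triv Z i).toOpenPartialHomeomorph ≫ₕ f).symm ≫ₕ
        ((triv Z j).toOpenPartialHomeomorph ≫ₕ f')).source ∩ range (IB.prod IF)) := by
  have h1 := contMDiffOn_of_mem_maximalAtlas hf'
  have h2 := contMDiffOn_symm_of_mem_maximalAtlas hf
  have h3 := contMDiffOn_trivChange IB IF (Z := Z) i j
  rw [← contMDiffOn_iff_contDiffOn]
  refine (IB.prod IF).contMDiff.comp_contMDiffOn ?_
  have h4 := (IB.prod IF).contMDiffOn_symm (n := ∞)
  refine h1.comp (h3.comp (h2.comp (h4.mono inter_subset_right) ?_) ?_) ?_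
  · rintro y ⟨⟨hy, -⟩, -⟩
    exact hy.1
  · rintro y ⟨⟨hy, hy'⟩, -⟩
    exact ⟨hy.2, hy'.1⟩
  · rintro y ⟨⟨hy, hy'⟩, -⟩
    exact hy'.2

variable [IsManifold IB ∞ B] [IsManifold IF ∞ F]

/-- The glued space is a smooth manifold. -/
instance [SmoothCore IB IF Z] : IsManifold (IB.prod IF) ∞ (Glued Z) := by
  refine isManifold_of_contDiffOn _ _ _ ?_
  rintro _ _ ⟨_, ⟨i, rfl⟩, f, hf, rfl⟩ ⟨_, ⟨j, rfl⟩, f', hf', rfl⟩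
  exact contDiffOn_transition IB IF i j (StructureGroupoid.subset_maximalAtlas _ hf)
    (StructureGroupoid.subset_maximalAtlas _ hf')

section Smooth

variable [SmoothCore IB IF Z]

/-- Local trivializations composed with charts of `B × F` are charts of the glued manifold. -/
theorem triv_trans_mem_maximalAtlas (i : ι) {f : OpenPartialHomeomorph (B × F) (ModelProd HB HF)}
    (hf : f ∈ IsManifold.maximalAtlas (IB.prod IF) ∞ (B × F)) :
    (triv Z i).toOpenPartialHomeomorph ≫ₕ f ∈
      IsManifold.maximalAtlas (IB.prod IF) ∞ (Glued Z) := by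
  rintro _ ⟨_, ⟨j, rfl⟩, f', hf', rfl⟩
  have hf'' : f' ∈ IsManifold.maximalAtlas (IB.prod IF) ∞ (B × F) :=
    StructureGroupoid.subset_maximalAtlas _ hf'
  exact ⟨mem_groupoid_of_pregroupoid.2 ⟨contDiffOn_transition IB IF i j hf hf'',
    contDiffOn_transition IB IF j i hf'' hf⟩, mem_groupoid_of_pregroupoid.2
    ⟨contDiffOn_transition IB IF j i hf'' hf, contDiffOn_transition IB IF i j hf hf''⟩⟩

theorem contMDiffOn_triv (i : ι) :
    ContMDiffOn (IB.prod IF) (IB.prod IF) ∞ (triv Z i) (triv Z i).source := by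
  intro x hx
  have hc := triv_trans_mem_maximalAtlas IB IF (Z := Z) i
    (IsManifold.chart_mem_maximalAtlas (I := IB.prod IF) (n := ∞) (triv Z i x))
  have h1 := contMDiffOn_of_mem_maximalAtlas hc
  have h2 := contMDiffOn_symm_of_mem_maximalAtlas
    (IsManifold.chart_mem_maximalAtlas (I := IB.prod IF) (n := ∞) (triv Z i x))
  have hx' : x ∈ ((triv Z i).toOpenPartialHomeomorph ≫ₕ
      chartAt (ModelProd HB HF) (triv Z i x)).source :=
    ⟨hx, mem_chart_source (ModelProd HB HF) (triv Z i x)⟩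
  have h3 := (h2.comp h1 (fun y hy => (chartAt (ModelProd HB HF) (triv Z i x)).map_source hy.2)) x hx'
  refine ContMDiffAt.contMDiffWithinAt ?_
  refine (h3.contMDiffAt (OpenPartialHomeomorph.open_source _ |>.mem_nhds hx')).congr_of_eventuallyEq ?_
  filter_upwards [OpenPartialHomeomorph.open_source _ |>.mem_nhds hx'] with y hy
  exact ((chartAt (ModelProd HB HF) (triv Z i x)).left_inv hy.2).symm

theorem contMDiffOn_triv_symm (i : ι) :
    ContMDiffOn (IB.prod IF) (IB.prod IF) ∞ (triv Z i).toOpenPartialHomeomorph.symm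
      (triv Z i).target := by
  intro y hy
  have hc := triv_trans_mem_maximalAtlas IB IF (Z := Z) i
    (IsManifold.chart_mem_maximalAtlas (I := IB.prod IF) (n := ∞) y)
  have h1 := contMDiffOn_symm_of_mem_maximalAtlas hc
  have h2 := contMDiffOn_of_mem_maximalAtlas
    (IsManifold.chart_mem_maximalAtlas (I := IB.prod IF) (n := ∞) y)
  set c := chartAt (ModelProd HB HF) y
  have hs : ∀ z : B × F, z ∈ (c.source ∩ (triv Z i).target : Set (B × F)) →
      c z ∈ ((triv Z i).toOpenPartialHomeomorph ≫ₕ c).target := by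
    rintro z ⟨hz, hz'⟩
    refine ⟨c.map_source hz, ?_⟩
    change c.symm (c z) ∈ (triv Z i).target
    rw [c.left_inv hz]
    exact hz'
  have ho : (c.source ∩ (triv Z i).target : Set (B × F)) ∈ 𝓝 y :=
    (c.open_source.inter (triv Z i).open_target).mem_nhds ⟨mem_chart_source _ y, hy⟩
  have h3 := (h1.comp (h2.mono inter_subset_left) hs) y ⟨mem_chart_source _ y, hy⟩
  refine ContMDiffAt.contMDiffWithinAt ?_
  refine (h3.contMDiffAt ho).congr_of_eventuallyEq ?_
  filter_upwards [ho] with z hz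
  exact congrArg (triv Z i).toOpenPartialHomeomorph.symm (c.left_inv hz.1).symm

theorem contMDiff_proj : ContMDiff (IB.prod IF) IB ∞ (proj Z) := by
  intro x
  have hx : x ∈ (triv Z (Z.indexAt (proj Z x))).source := Z.mem_baseSet_at _
  have h := (contMDiff_fst.comp_contMDiffOn (contMDiffOn_triv IB IF (Z := Z)
    (Z.indexAt (proj Z x)))).contMDiffAt ((triv Z _).open_source.mem_nhds hx)
  refine h.congr_of_eventuallyEq ?_
  filter_upwards [(triv Z _).open_source.mem_nhds hx] with y hy
  exact ((triv Z _).coe_fst hy).symm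

end Smooth

section Submersion

variable {EB' HB' EF' HF' : Type*} [NormedAddCommGroup EB'] [NormedSpace ℝ EB']
  [TopologicalSpace HB'] [NormedAddCommGroup EF'] [NormedSpace ℝ EF'] [TopologicalSpace HF']
  (IB' : ModelWithCorners ℝ EB' HB') (IF' : ModelWithCorners ℝ EF' HF')
  {ι' B' F' : Type*} [TopologicalSpace B'] [ChartedSpace HB' B'] [IsManifold IB' ∞ B']
  [TopologicalSpace F'] [ChartedSpace HF' F'] [IsManifold IF' ∞ F']
  {Z' : FiberBundleCore ι' B' F'} [SmoothCore IB IF Z] [SmoothCore IB' IF' Z']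

theorem isSubmersion_of_local {φ : B × F → B' × F'}
    (hφ : Manifold.IsSubmersion (IB.prod IF) (IB'.prod IF') ∞ φ) {f : Glued Z → Glued Z'}
    (hf : ∀ x, ∃ i j, x ∈ (triv Z i).source ∧ ∀ y ∈ (triv Z i).source,
      f y ∈ (triv Z' j).source ∧ triv Z' j (f y) = φ (triv Z i y)) :
    Manifold.IsSubmersion (IB.prod IF) (IB'.prod IF') ∞ f := by
  refine ⟨hφ.complement, inferInstance, inferInstance, fun x => ?_⟩
  obtain ⟨i, j, hx, h⟩ := hf x
  have hs := hφ.isSubmersionOfComplement_complement (triv Z i x)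
  refine Manifold.IsSubmersionAtOfComplement.mk_of_charts hs.equiv
    ((triv Z i).toOpenPartialHomeomorph ≫ₕ hs.domChart)
    ((triv Z' j).toOpenPartialHomeomorph ≫ₕ hs.codChart) ⟨hx, hs.mem_domChart_source⟩
    ⟨(h x hx).1, ?_⟩ (triv_trans_mem_maximalAtlas IB IF i hs.domChart_mem_maximalAtlas)
    (triv_trans_mem_maximalAtlas IB' IF' j hs.codChart_mem_maximalAtlas) ?_ ?_
  · change triv Z' j (f x) ∈ hs.codChart.source
    rw [(h x hx).2]
    exact hs.mem_codChart_source
  · rintro y ⟨hy, hy'⟩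
    refine ⟨(h y hy).1, ?_⟩
    change triv Z' j (f y) ∈ hs.codChart.source
    rw [(h y hy).2]
    exact hs.source_subset_preimage_source hy'
  · intro u hu
    obtain ⟨hu1, hu2⟩ := hu
    have hu3 : u ∈ (hs.domChart.extend (IB.prod IF)).target := ⟨hu1, hu2.1⟩
    have hz : (triv Z i).toOpenPartialHomeomorph.symm
        (hs.domChart.symm ((IB.prod IF).symm u)) ∈ (triv Z i).source :=
      (triv Z i).toOpenPartialHomeomorph.map_target hu2.2
    have hr : triv Z i ((triv Z i).toOpenPartialHomeomorph.symm
        (hs.domChart.symm ((IB.prod IF).symm u))) = hs.domChart.symm ((IB.prod IF).symm u) :=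
      (triv Z i).toOpenPartialHomeomorph.right_inv hu2.2
    rw [← hs.writtenInCharts hu3]
    change (IB'.prod IF') (hs.codChart (triv Z' j (f ((triv Z i).toOpenPartialHomeomorph.symm
      (hs.domChart.symm ((IB.prod IF).symm u)))))) = _
    rw [(h _ hz).2, hr]
    rfl

end Submersion

end Glued
end Glued

/-! ### Principaloid bundles -/

section PrincipaloidBundles

variable {EM HM EG HG ES HS EP HP : Type*}
  [NormedAddCommGroup EM] [NormedSpace ℝ EM] [TopologicalSpace HM]
  [NormedAddCommGroup EG] [NormedSpace ℝ EG] [TopologicalSpace HG]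
  [NormedAddCommGroup ES] [NormedSpace ℝ ES] [TopologicalSpace HS]
  [NormedAddCommGroup EP] [NormedSpace ℝ EP] [TopologicalSpace HP]
  {I : ModelWithCorners ℝ EM HM} {J : ModelWithCorners ℝ EG HG}
  {M G : Type*} [TopologicalSpace M] [ChartedSpace HM M] [IsManifold I ∞ M]
  [TopologicalSpace G] [ChartedSpace HG G] [IsManifold J ∞ G]

/-- A right module space over a Lie groupoid: a manifold `P` with a moment map and a smooth right
action; `act p g` is meaningful when `moment p = trg g` (other values are irrelevant). -/
structure RightModule (𝒢 : LieGroupoid I J M G) (IP : ModelWithCorners ℝ EP HP)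
    (P : Type*) [TopologicalSpace P] [ChartedSpace HP P] [IsManifold IP ∞ P] where
  /-- the moment map -/
  moment : P → M
  /-- the action map -/
  act : P → G → P
  contMDiff_moment : ContMDiff IP I ∞ moment
  contMDiffOn_act :
    ContMDiffOn (IP.prod J) IP ∞ (fun x : P × G => act x.1 x.2) {x | moment x.1 = 𝒢.trg x.2}
  moment_act : ∀ p g, moment p = 𝒢.trg g → moment (act p g) = 𝒢.src g
  act_unit : ∀ p, act p (𝒢.unit (moment p)) = p
  act_act : ∀ p g h, moment p = 𝒢.trg g → 𝒢.src g = 𝒢.trg h →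
    act (act p g) h = act p (𝒢.mul g h)

variable {𝒢 : LieGroupoid I J M G} {IP : ModelWithCorners ℝ EP HP} (IS : ModelWithCorners ℝ ES HS)
  {P S : Type*} [TopologicalSpace P] [ChartedSpace HP P] [IsManifold IP ∞ P]
  [TopologicalSpace S] [ChartedSpace HS S] [IsManifold IS ∞ S]

/-- A local trivialization `q⁻¹(O) ≃ O × G` which is a diffeomorphism and is equivariant for the
right action and for right translations of `G` (whose moment map is the source map). -/
structure IsEquivariantTrivialization (X : RightModule 𝒢 IP P) {q : P → S}
    (e : Trivialization G q) : Prop where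
  contMDiffOn : ContMDiffOn IP (IS.prod J) ∞ e e.source
  contMDiffOn_symm : ContMDiffOn (IS.prod J) IP ∞ e.toOpenPartialHomeomorph.symm e.target
  moment_eq : ∀ p ∈ e.source, X.moment p = 𝒢.src (e p).2
  act_eq : ∀ p ∈ e.source, ∀ g, X.moment p = 𝒢.trg g → e (X.act p g) = (q p, 𝒢.mul (e p).2 g)

variable (𝒢 IP P S) in
/-- A principaloid bundle over the base `S` with structure groupoid `𝒢`: a fibre bundle object,
with typical fibre `G`, in the category of right `𝒢`-modules, with fibrewise action. -/
structure PrincipaloidBundle extends RightModule 𝒢 IP P where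
  /-- the base projection -/
  proj : P → S
  surjective_proj : Function.Surjective proj
  isSubmersion_proj : Manifold.IsSubmersion IP IS ∞ proj
  proj_act : ∀ p g, moment p = 𝒢.trg g → proj (act p g) = proj p
  locally_trivial : ∀ σ : S, ∃ e : Trivialization G proj,
    σ ∈ e.baseSet ∧ IsEquivariantTrivialization IS toRightModule e

variable {IS}

/-- A trivializing cover of the base, with equivariant local trivializations. -/
structure TrivializingCover (𝔓 : PrincipaloidBundle 𝒢 IP IS P S) (ι : Type*) where
  /-- the local trivialization with index `i`, over the open set `(triv i).baseSet` -/
  triv : ι → Trivialization G 𝔓.proj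
  equivariant : ∀ i, IsEquivariantTrivialization IS 𝔓.toRightModule (triv i)
  exists_mem : ∀ σ : S, ∃ i, σ ∈ (triv i).baseSet

namespace TrivializingCover

variable {𝔓 : PrincipaloidBundle 𝒢 IP IS P S} {ι : Type*} (A : TrivializingCover 𝔓 ι)

/-- The open set `Oᵢ` of the cover. -/
def base (i : ι) : Set S := (A.triv i).baseSet

theorem isOpen_base (i : ι) : IsOpen (A.base i) := (A.triv i).open_baseSet

/-- Some index whose open set contains the given point. -/
def indexAt (σ : S) : ι := (A.exists_mem σ).choose

theorem mem_indexAt (σ : S) : σ ∈ A.base (A.indexAt σ) := (A.exists_mem σ).choose_spec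

/-- The point `τᵢ⁻¹(σ, g)` of the total space. -/
def pt (i : ι) (σ : S) (g : G) : P := (A.triv i).toOpenPartialHomeomorph.symm (σ, g)

/-- The second component of `τᵢ ∘ τⱼ⁻¹`. -/
def trans (i j : ι) (σ : S) (g : G) : G := (A.triv i (A.pt j σ g)).2

variable {A}

theorem pt_mem_source {j : ι} {σ : S} (hj : σ ∈ A.base j) (g : G) :
    A.pt j σ g ∈ (A.triv j).source :=
  (A.triv j).toOpenPartialHomeomorph.map_target ((A.triv j).mem_target.2 hj)

theorem triv_pt {j : ι} {σ : S} (hj : σ ∈ A.base j) (g : G) :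
    A.triv j (A.pt j σ g) = (σ, g) :=
  (A.triv j).toOpenPartialHomeomorph.right_inv ((A.triv j).mem_target.2 hj)

theorem proj_pt {j : ι} {σ : S} (hj : σ ∈ A.base j) (g : G) : 𝔓.proj (A.pt j σ g) = σ := by
  rw [← (A.triv j).coe_fst (pt_mem_source hj g), triv_pt hj]

theorem moment_pt {j : ι} {σ : S} (hj : σ ∈ A.base j) (g : G) :
    𝔓.moment (A.pt j σ g) = 𝒢.src g := by
  rw [(A.equivariant j).moment_eq _ (pt_mem_source hj g), triv_pt hj]

theorem mem_source_of_proj_mem {i : ι} {p : P} (h : 𝔓.proj p ∈ A.base i) :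
    p ∈ (A.triv i).source := (A.triv i).mem_source.2 h

theorem pt_mem_source' {i j : ι} {σ : S} (hi : σ ∈ A.base i) (hj : σ ∈ A.base j) (g : G) :
    A.pt j σ g ∈ (A.triv i).source :=
  mem_source_of_proj_mem (by rwa [proj_pt hj])

theorem pt_snd {i : ι} {p : P} (h : 𝔓.proj p ∈ A.base i) :
    A.pt i (𝔓.proj p) (A.triv i p).2 = p := by
  have hp := mem_source_of_proj_mem h
  rw [← (A.triv i).coe_fst hp]
  exact (A.triv i).toOpenPartialHomeomorph.left_inv hp

theorem pt_act {j : ι} {σ : S} (hj : σ ∈ A.base j) {g h : G} (e : 𝒢.src g = 𝒢.trg h) :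
    𝔓.act (A.pt j σ g) h = A.pt j σ (𝒢.mul g h) := by
  have hm : 𝔓.moment (A.pt j σ g) = 𝒢.trg h := by rw [moment_pt hj, e]
  have h1 := (A.equivariant j).act_eq _ (pt_mem_source hj g) h hm
  rw [proj_pt hj, triv_pt hj] at h1
  have hp : 𝔓.proj (𝔓.act (A.pt j σ g) h) = σ := by rw [𝔓.proj_act _ _ hm, proj_pt hj]
  have h2 := pt_snd (A := A) (i := j) (p := 𝔓.act (A.pt j σ g) h) (by rwa [hp])
  rw [hp, h1] at h2
  exact h2.symm

section Overlap

variable {i j k : ι} {σ : S}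

theorem pt_trans (hi : σ ∈ A.base i) (hj : σ ∈ A.base j) (g : G) :
    A.pt i σ (A.trans i j σ g) = A.pt j σ g := by
  have := pt_snd (A := A) (i := i) (p := A.pt j σ g) (by rwa [proj_pt hj])
  rwa [proj_pt hj] at this

theorem trans_trans (hi : σ ∈ A.base i) (hj : σ ∈ A.base j) (hk : σ ∈ A.base k) (g : G) :
    A.trans i j σ (A.trans j k σ g) = A.trans i k σ g := by
  rw [trans, pt_trans hj hk, ← trans]

theorem trans_self (hi : σ ∈ A.base i) (g : G) : A.trans i i σ g = g := by
  rw [trans, triv_pt hi]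

theorem src_trans (hi : σ ∈ A.base i) (hj : σ ∈ A.base j) (g : G) :
    𝒢.src (A.trans i j σ g) = 𝒢.src g := by
  rw [trans, ← (A.equivariant i).moment_eq _ (pt_mem_source' hi hj g), moment_pt hj]

theorem trans_mul (hi : σ ∈ A.base i) (hj : σ ∈ A.base j) {g h : G} (e : 𝒢.src g = 𝒢.trg h) :
    A.trans i j σ (𝒢.mul g h) = 𝒢.mul (A.trans i j σ g) h := by
  have hm : 𝔓.moment (A.pt j σ g) = 𝒢.trg h := by rw [moment_pt hj, e]
  rw [trans, ← pt_act hj e, (A.equivariant i).act_eq _ (pt_mem_source' hi hj g) h hm]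
  rfl

theorem trans_eq (hi : σ ∈ A.base i) (hj : σ ∈ A.base j) (g : G) :
    A.trans i j σ g = 𝒢.mul (A.trans i j σ (𝒢.unit (𝒢.trg g))) g := by
  rw [← trans_mul hi hj (𝒢.src_unit _), 𝒢.unit_mul]

theorem trg_trans_inv (hi : σ ∈ A.base i) (hj : σ ∈ A.base j) (m : M) :
    𝒢.trg (A.trans i j σ (𝒢.unit (𝒢.trg (A.trans j i σ (𝒢.unit m))))) = m := by
  have h := trans_trans hi hj hi (𝒢.unit m)
  rw [trans_self hi, trans_eq hi hj] at h
  have h2 := congrArg 𝒢.trg h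
  rw [𝒢.trg_mul _ _ (by rw [src_trans hi hj, 𝒢.src_unit]), 𝒢.trg_unit] at h2
  exact h2

end Overlap

variable (A)

theorem contMDiffOn_trans (i j : ι) :
    ContMDiffOn (IS.prod J) J ∞ (fun p : S × G => A.trans i j p.1 p.2)
      ((A.base i ∩ A.base j) ×ˢ univ) := by
  have h1 := (A.equivariant i).contMDiffOn
  have h2 := (A.equivariant j).contMDiffOn_symm.mono
    (t := (A.base i ∩ A.base j) ×ˢ univ) (fun p hp => (A.triv j).mem_target.2 hp.1.2)
  exact contMDiff_snd.comp_contMDiffOn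
    (h1.comp h2 (fun p hp => pt_mem_source' hp.1.1 hp.1.2 p.2))

theorem contMDiff_trans_unit {i j : ι} {σ : S} (hi : σ ∈ A.base i) (hj : σ ∈ A.base j) :
    ContMDiff I J ∞ (fun m => A.trans i j σ (𝒢.unit m)) := by
  have h : ContMDiff I (IS.prod J) ∞ (fun m => (σ, 𝒢.unit m)) :=
    contMDiff_const.prodMk 𝒢.contMDiff_unit
  rw [← contMDiffOn_univ] at h ⊢
  exact (A.contMDiffOn_trans i j).comp h (fun m _ => ⟨⟨hi, hj⟩, trivial⟩)

open Classical in
/-- The transition cocycle `βᵢⱼ : Oᵢ ∩ Oⱼ → Bisec(𝒢)` of the trivializing cover, characterised by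
`τᵢ(τⱼ⁻¹(σ, g)) = (σ, βᵢⱼ(σ) ▷ g)`, so that `βᵢⱼ(σ)(m)` is the second component of
`τᵢ(τⱼ⁻¹(σ, Id_m))`. (It is set to `1` outside `Oᵢ ∩ Oⱼ`.) -/
def cocycle (i j : ι) (σ : S) : Bisection 𝒢 :=
  if h : σ ∈ A.base i ∧ σ ∈ A.base j then
    { toFun := fun m => A.trans i j σ (𝒢.unit m)
      contMDiff_toFun := A.contMDiff_trans_unit h.1 h.2
      src_toFun := fun m => by rw [src_trans h.1 h.2, 𝒢.src_unit]
      exists_diffeomorph := ⟨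
        { toFun := fun m => 𝒢.trg (A.trans i j σ (𝒢.unit m))
          invFun := fun m => 𝒢.trg (A.trans j i σ (𝒢.unit m))
          left_inv := trg_trans_inv h.2 h.1
          right_inv := trg_trans_inv h.1 h.2
          contMDiff_toFun := 𝒢.contMDiff_trg.comp (A.contMDiff_trans_unit h.1 h.2)
          contMDiff_invFun := 𝒢.contMDiff_trg.comp (A.contMDiff_trans_unit h.2 h.1) },
        fun _ => rfl⟩ }
  else 1

variable {A}

section Cocycle

variable {i j k : ι} {σ : S}

theorem cocycle_apply (hi : σ ∈ A.base i) (hj : σ ∈ A.base j) (m : M) :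
    A.cocycle i j σ m = A.trans i j σ (𝒢.unit m) := by
  rw [cocycle, dif_pos ⟨hi, hj⟩]

theorem cocycle_leftMul (hi : σ ∈ A.base i) (hj : σ ∈ A.base j) (g : G) :
    (A.cocycle i j σ).leftMul g = A.trans i j σ g := by
  rw [Bisection.leftMul, cocycle_apply hi hj, ← trans_eq hi hj]

theorem triv_pt_eq_cocycle (hi : σ ∈ A.base i) (hj : σ ∈ A.base j) (g : G) :
    A.triv i (A.pt j σ g) = (σ, (A.cocycle i j σ).leftMul g) := by
  rw [cocycle_leftMul hi hj]
  refine Prod.ext ?_ rfl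
  rw [(A.triv i).coe_fst (pt_mem_source' hi hj g), proj_pt hj]

theorem cocycle_mul (hi : σ ∈ A.base i) (hj : σ ∈ A.base j) (hk : σ ∈ A.base k) :
    A.cocycle i j σ * A.cocycle j k σ = A.cocycle i k σ := by
  refine Bisection.ext_fun fun m => ?_
  rw [Bisection.mul_apply, ← Bisection.leftMul, cocycle_leftMul hi hj, cocycle_apply hj hk,
    trans_trans hi hj hk, cocycle_apply hi hk]

theorem cocycle_self (hi : σ ∈ A.base i) : A.cocycle i i σ = 1 := by
  have := cocycle_mul hi hi hi
  exact mul_eq_left.1 this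

theorem cocycle_inv (hi : σ ∈ A.base i) (hj : σ ∈ A.base j) :
    (A.cocycle i j σ)⁻¹ = A.cocycle j i σ := by
  refine inv_eq_of_mul_eq_one_right ?_
  rw [cocycle_mul hi hj hi, cocycle_self hi]

theorem shadow_cocycle (hi : σ ∈ A.base i) (hj : σ ∈ A.base j) (m : M) :
    (A.cocycle i j σ).shadow m = 𝒢.trg (A.trans i j σ (𝒢.unit m)) := by
  rw [Bisection.shadow_apply, cocycle_apply hi hj]

theorem rightMul_cocycle (hi : σ ∈ A.base i) (hj : σ ∈ A.base j) (g : G) :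
    Bisection.rightMul g (A.cocycle i j σ) = 𝒢.inv (A.trans j i σ (𝒢.inv g)) := by
  rw [← Bisection.inv_leftMul_inv, cocycle_inv hi hj, cocycle_leftMul hj hi]

end Cocycle

variable (A)

/-! ### The shadow bundle -/

theorem contMDiffOn_shadow_cocycle (i j : ι) :
    ContMDiffOn (IS.prod I) I ∞ (fun p : S × M => (A.cocycle j i p.1).shadow p.2)
      ((A.base i ∩ A.base j) ×ˢ univ) := by
  have h : ContMDiff (IS.prod I) (IS.prod J) ∞ (fun p : S × M => (p.1, 𝒢.unit p.2)) :=
    contMDiff_fst.prodMk (𝒢.contMDiff_unit.comp contMDiff_snd)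
  refine (𝒢.contMDiff_trg.comp_contMDiffOn ((A.contMDiffOn_trans j i).comp h.contMDiffOn
    (t := (A.base j ∩ A.base i) ×ˢ univ) (s := (A.base i ∩ A.base j) ×ˢ univ)
    (fun p hp => ⟨⟨hp.1.2, hp.1.1⟩, trivial⟩))).congr fun p hp => ?_
  exact shadow_cocycle hp.1.2 hp.1.1 p.2

/-- The gluing data of the shadow bundle: `Oᵢ × M`, glued by the shadow action of the cocycle. -/
def shadowCore : FiberBundleCore ι S M where
  baseSet := A.base
  isOpen_baseSet := A.isOpen_base
  indexAt := A.indexAt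
  mem_baseSet_at := A.mem_indexAt
  coordChange i j σ m := (A.cocycle j i σ).shadow m
  coordChange_self i σ hi m := by rw [cocycle_self hi, Bisection.shadow_one]
  continuousOn_coordChange i j := (A.contMDiffOn_shadow_cocycle i j).continuousOn
  coordChange_comp i j k σ h m := by
    rw [← Bisection.shadow_mul, cocycle_mul h.2 h.1.2 h.1.1]

instance : SmoothCore IS I A.shadowCore := ⟨A.contMDiffOn_shadow_cocycle⟩

/-- The shadow bundle `ℱ` over the base: the `Oᵢ × M` glued by
`(σ, m, j) ∼ (σ, t_*(βᵢⱼ(σ))(m), i)`. -/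
abbrev Shadow : Type _ := Glued A.shadowCore

/-- The class `[(σ, m, i)]` in the shadow bundle, for `σ ∈ Oᵢ`. -/
def Shadow.mk (i : ι) (σ : S) (m : M) : A.Shadow :=
  (Glued.triv A.shadowCore i).toOpenPartialHomeomorph.symm (σ, m)

/-- The base projection of the shadow bundle. -/
abbrev Shadow.proj : A.Shadow → S := Glued.proj A.shadowCore

/-! ### The Atiyah-Ehresmann groupoid -/

theorem contMDiffOn_atiyah_coordChange (i j : ι × ι) :
    ContMDiffOn ((IS.prod IS).prod J) J ∞
      (fun p : (S × S) × G => (A.cocycle j.1 i.1 p.1.1).leftMul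
        (Bisection.rightMul p.2 (A.cocycle i.2 j.2 p.1.2)))
      ((A.base i.1 ×ˢ A.base i.2 ∩ A.base j.1 ×ˢ A.base j.2) ×ˢ univ) := by
  set s : Set ((S × S) × G) := (A.base i.1 ×ˢ A.base i.2 ∩ A.base j.1 ×ˢ A.base j.2) ×ˢ univ
  have h1 : ContMDiff ((IS.prod IS).prod J) (IS.prod J) ∞
      (fun p : (S × S) × G => (p.1.2, 𝒢.inv p.2)) :=
    (contMDiff_snd.comp contMDiff_fst).prodMk (𝒢.contMDiff_inv.comp contMDiff_snd)
  have h2 : ContMDiffOn ((IS.prod IS).prod J) J ∞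
      (fun p : (S × S) × G => 𝒢.inv (A.trans j.2 i.2 p.1.2 (𝒢.inv p.2))) s :=
    𝒢.contMDiff_inv.comp_contMDiffOn ((A.contMDiffOn_trans j.2 i.2).comp h1.contMDiffOn
      (fun p hp => ⟨⟨hp.1.2.2, hp.1.1.2⟩, trivial⟩))
  have h3 : ContMDiffOn ((IS.prod IS).prod J) (IS.prod J) ∞
      (fun p : (S × S) × G => (p.1.1, 𝒢.inv (A.trans j.2 i.2 p.1.2 (𝒢.inv p.2)))) s :=
    (contMDiff_fst.comp contMDiff_fst).contMDiffOn.prodMk h2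
  refine ((A.contMDiffOn_trans j.1 i.1).comp h3
    (fun p hp => ⟨⟨hp.1.2.1, hp.1.1.1⟩, trivial⟩)).congr fun p hp => ?_
  rw [cocycle_leftMul hp.1.2.1 hp.1.1.1, rightMul_cocycle hp.1.1.2 hp.1.2.2]
  rfl

/-- The gluing data of the Atiyah bundle: the `Oᵢ × G × Oⱼ`, glued by left multiplication with the
cocycle over the first factor and right multiplication with the cocycle over the second one. -/
def atiyahCore : FiberBundleCore (ι × ι) (S × S) G where
  baseSet i := A.base i.1 ×ˢ A.base i.2
  isOpen_baseSet i := (A.isOpen_base i.1).prod (A.isOpen_base i.2)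
  indexAt σ := (A.indexAt σ.1, A.indexAt σ.2)
  mem_baseSet_at σ := ⟨A.mem_indexAt σ.1, A.mem_indexAt σ.2⟩
  coordChange i j σ g :=
    (A.cocycle j.1 i.1 σ.1).leftMul (Bisection.rightMul g (A.cocycle i.2 j.2 σ.2))
  coordChange_self i σ hi g := by
    rw [cocycle_self hi.1, cocycle_self hi.2, Bisection.rightMul_one, Bisection.one_leftMul]
  continuousOn_coordChange i j := (A.contMDiffOn_atiyah_coordChange i j).continuousOn
  coordChange_comp i j k σ h g := by
    rw [← Bisection.leftMul_rightMul, ← Bisection.mul_leftMul, ← Bisection.rightMul_mul,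
      cocycle_mul h.2.1 h.1.2.1 h.1.1.1, cocycle_mul h.1.1.2 h.1.2.2 h.2.2]

instance : SmoothCore (IS.prod IS) J A.atiyahCore := ⟨A.contMDiffOn_atiyah_coordChange⟩

/-- The arrow manifold `At(𝔓)` of the Atiyah-Ehresmann groupoid: the `Oᵢ × G × Oⱼ` glued by
`(σ₁, g, σ₂, k, l) ∼ (σ₁, βᵢₖ(σ₁) ▷ g ◁ βₗⱼ(σ₂), σ₂, i, j)`. -/
abbrev Atiyah : Type _ := Glued A.atiyahCore

/-- The class `[(σ₁, g, σ₂, i, j)]` in `At(𝔓)`, for `σ₁ ∈ Oᵢ` and `σ₂ ∈ Oⱼ`. -/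
def Atiyah.mk (i : ι) (σ₁ : S) (g : G) (σ₂ : S) (j : ι) : A.Atiyah :=
  (Glued.triv A.atiyahCore (i, j)).toOpenPartialHomeomorph.symm ((σ₁, σ₂), g)

/-- The projection `π : At(𝔓) → S × S`, `[(σ₁, g, σ₂, i, j)] ↦ (σ₁, σ₂)`. -/
abbrev Atiyah.proj : A.Atiyah → S × S := Glued.proj A.atiyahCore

end TrivializingCover

namespace TrivializingCover

variable {𝔓 : PrincipaloidBundle 𝒢 IP IS P S} {ι : Type*} {A : TrivializingCover 𝔓 ι}

section Classes

variable {i j k l : ι} {σ σ₁ σ₂ σ₃ : S}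

theorem Shadow.proj_mk (hi : σ ∈ A.base i) (m : M) : Shadow.proj A (Shadow.mk A i σ m) = σ :=
  (Glued.triv A.shadowCore i).proj_symm_apply ((Glued.triv A.shadowCore i).mem_target.2 hi)

theorem Shadow.triv_mk (hi : σ ∈ A.base i) (m : M) :
    Glued.triv A.shadowCore i (Shadow.mk A i σ m) = (σ, m) :=
  (Glued.triv A.shadowCore i).toOpenPartialHomeomorph.right_inv
    ((Glued.triv A.shadowCore i).mem_target.2 hi)

/-- The gluing relation of the shadow bundle. -/
theorem Shadow.mk_eq (hi : σ ∈ A.base i) (hj : σ ∈ A.base j) (m : M) :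
    Shadow.mk A i σ m = Shadow.mk A j σ ((A.cocycle j i σ).shadow m) :=
  Glued.triv_symm_eq (Z := A.shadowCore) hi hj m

theorem Shadow.mk_triv {x : A.Shadow} (hi : Shadow.proj A x ∈ A.base i) :
    Shadow.mk A i (Shadow.proj A x) (Glued.triv A.shadowCore i x).2 = x :=
  (Glued.triv A.shadowCore i).symm_apply_mk_proj hi

theorem Atiyah.proj_mk (hi : σ₁ ∈ A.base i) (hj : σ₂ ∈ A.base j) (g : G) :
    Atiyah.proj A (Atiyah.mk A i σ₁ g σ₂ j) = (σ₁, σ₂) :=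
  (Glued.triv A.atiyahCore (i, j)).proj_symm_apply
    ((Glued.triv A.atiyahCore (i, j)).mem_target.2 ⟨hi, hj⟩)

theorem Atiyah.triv_mk (hi : σ₁ ∈ A.base i) (hj : σ₂ ∈ A.base j) (g : G) :
    Glued.triv A.atiyahCore (i, j) (Atiyah.mk A i σ₁ g σ₂ j) = ((σ₁, σ₂), g) :=
  (Glued.triv A.atiyahCore (i, j)).toOpenPartialHomeomorph.right_inv
    ((Glued.triv A.atiyahCore (i, j)).mem_target.2 ⟨hi, hj⟩)

/-- The gluing relation of the Atiyah-Ehresmann groupoid. -/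
theorem Atiyah.mk_eq (hi : σ₁ ∈ A.base i) (hj : σ₂ ∈ A.base j) (hk : σ₁ ∈ A.base k)
    (hl : σ₂ ∈ A.base l) (g : G) :
    Atiyah.mk A i σ₁ g σ₂ j = Atiyah.mk A k σ₁
      ((A.cocycle k i σ₁).leftMul (Bisection.rightMul g (A.cocycle j l σ₂))) σ₂ l :=
  Glued.triv_symm_eq (Z := A.atiyahCore) (i := (i, j)) (j := (k, l)) ⟨hi, hj⟩ ⟨hk, hl⟩ g

theorem Atiyah.mk_triv {x : A.Atiyah} (hi : (Atiyah.proj A x).1 ∈ A.base i)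
    (hj : (Atiyah.proj A x).2 ∈ A.base j) :
    Atiyah.mk A i (Atiyah.proj A x).1 (Glued.triv A.atiyahCore (i, j) x).2
      (Atiyah.proj A x).2 j = x :=
  (Glued.triv A.atiyahCore (i, j)).symm_apply_mk_proj ⟨hi, hj⟩

/-- The fibre coordinate of a point of the shadow bundle, in the trivialization with the index
`indexAt`. -/
def Shadow.coord (x : A.Shadow) : M :=
  (Glued.triv A.shadowCore (A.indexAt (Shadow.proj A x)) x).2

/-- The fibre coordinate of a point of `At(𝔓)`, in the trivialization with the indices
`indexAt`. -/
def Atiyah.coord (x : A.Atiyah) : G :=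
  (Glued.triv A.atiyahCore
    (A.indexAt (Atiyah.proj A x).1, A.indexAt (Atiyah.proj A x).2) x).2

theorem Shadow.mk_coord (x : A.Shadow) :
    Shadow.mk A (A.indexAt (Shadow.proj A x)) (Shadow.proj A x) (Shadow.coord x) = x :=
  Shadow.mk_triv (A.mem_indexAt _)

theorem Atiyah.mk_coord (x : A.Atiyah) :
    Atiyah.mk A (A.indexAt (Atiyah.proj A x).1) (Atiyah.proj A x).1 (Atiyah.coord x)
      (Atiyah.proj A x).2 (A.indexAt (Atiyah.proj A x).2) = x :=
  Atiyah.mk_triv (A.mem_indexAt _) (A.mem_indexAt _)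

theorem Shadow.coord_mk (hi : σ ∈ A.base i) (m : M) :
    Shadow.coord (Shadow.mk A i σ m) = (A.cocycle (A.indexAt σ) i σ).shadow m := by
  rw [Shadow.coord, Shadow.proj_mk hi, Shadow.mk_eq hi (A.mem_indexAt σ),
    Shadow.triv_mk (A.mem_indexAt σ)]

theorem Atiyah.coord_mk (hi : σ₁ ∈ A.base i) (hj : σ₂ ∈ A.base j) (g : G) :
    Atiyah.coord (Atiyah.mk A i σ₁ g σ₂ j) = (A.cocycle (A.indexAt σ₁) i σ₁).leftMul
      (Bisection.rightMul g (A.cocycle j (A.indexAt σ₂) σ₂)) := by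
  rw [Atiyah.coord, Atiyah.proj_mk hi hj,
    Atiyah.mk_eq hi hj (A.mem_indexAt σ₁) (A.mem_indexAt σ₂),
    Atiyah.triv_mk (A.mem_indexAt σ₁) (A.mem_indexAt σ₂)]

theorem Shadow.coord_mk_indexAt (m : M) : Shadow.coord (Shadow.mk A (A.indexAt σ) σ m) = m := by
  rw [Shadow.coord_mk (A.mem_indexAt σ), cocycle_self (A.mem_indexAt σ), Bisection.shadow_one]

theorem Atiyah.coord_mk_indexAt (g : G) :
    Atiyah.coord (Atiyah.mk A (A.indexAt σ₁) σ₁ g σ₂ (A.indexAt σ₂)) = g := by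
  rw [Atiyah.coord_mk (A.mem_indexAt σ₁) (A.mem_indexAt σ₂), cocycle_self (A.mem_indexAt σ₁),
    cocycle_self (A.mem_indexAt σ₂), Bisection.rightMul_one, Bisection.one_leftMul]

theorem Shadow.proj_mk_indexAt (m : M) :
    Shadow.proj A (Shadow.mk A (A.indexAt σ) σ m) = σ :=
  Shadow.proj_mk (A.mem_indexAt σ) m

theorem Atiyah.proj_mk_indexAt (g : G) :
    Atiyah.proj A (Atiyah.mk A (A.indexAt σ₁) σ₁ g σ₂ (A.indexAt σ₂)) = (σ₁, σ₂) :=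
  Atiyah.proj_mk (A.mem_indexAt σ₁) (A.mem_indexAt σ₂) g

/-! The structure maps, defined with the representatives given by `coord`; the formulas for
arbitrary representatives are `src_mk`, `trg_mk`, `unit_mk`, `inv_mk` and `mul_mk`. -/

/-- The source map `[(σ₁, g, σ₂, i, j)] ↦ [(σ₂, s(g), j)]`. -/
def Atiyah.src (x : A.Atiyah) : A.Shadow :=
  Shadow.mk A (A.indexAt (Atiyah.proj A x).2) (Atiyah.proj A x).2 (𝒢.src (Atiyah.coord x))

/-- The target map `[(σ₁, g, σ₂, i, j)] ↦ [(σ₁, t(g), i)]`. -/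
def Atiyah.trg (x : A.Atiyah) : A.Shadow :=
  Shadow.mk A (A.indexAt (Atiyah.proj A x).1) (Atiyah.proj A x).1 (𝒢.trg (Atiyah.coord x))

/-- The identity map `[(σ, m, i)] ↦ [(σ, Id_m, σ, i, i)]`. -/
def Atiyah.unit (x : A.Shadow) : A.Atiyah :=
  Atiyah.mk A (A.indexAt (Shadow.proj A x)) (Shadow.proj A x) (𝒢.unit (Shadow.coord x))
    (Shadow.proj A x) (A.indexAt (Shadow.proj A x))

/-- The inverse map `[(σ₁, g, σ₂, i, j)] ↦ [(σ₂, g⁻¹, σ₁, j, i)]`. -/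
def Atiyah.inv (x : A.Atiyah) : A.Atiyah :=
  Atiyah.mk A (A.indexAt (Atiyah.proj A x).2) (Atiyah.proj A x).2 (𝒢.inv (Atiyah.coord x))
    (Atiyah.proj A x).1 (A.indexAt (Atiyah.proj A x).1)

/-- The multiplication
`([(σ₁, g, σ₂, i, j)], [(σ₂, h, σ₃, j, l)]) ↦ [(σ₁, g . h, σ₃, i, l)]`. -/
def Atiyah.mul (x y : A.Atiyah) : A.Atiyah :=
  Atiyah.mk A (A.indexAt (Atiyah.proj A x).1) (Atiyah.proj A x).1
    (𝒢.mul (Atiyah.coord x) (Atiyah.coord y)) (Atiyah.proj A y).2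
    (A.indexAt (Atiyah.proj A y).2)

theorem Atiyah.src_mk (hi : σ₁ ∈ A.base i) (hj : σ₂ ∈ A.base j) (g : G) :
    Atiyah.src (Atiyah.mk A i σ₁ g σ₂ j) = Shadow.mk A j σ₂ (𝒢.src g) := by
  rw [Atiyah.src, Atiyah.proj_mk hi hj, Atiyah.coord_mk hi hj, Bisection.src_leftMul,
    Bisection.src_rightMul, cocycle_inv hj (A.mem_indexAt σ₂),
    ← Shadow.mk_eq hj (A.mem_indexAt σ₂)]

theorem Atiyah.trg_mk (hi : σ₁ ∈ A.base i) (hj : σ₂ ∈ A.base j) (g : G) :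
    Atiyah.trg (Atiyah.mk A i σ₁ g σ₂ j) = Shadow.mk A i σ₁ (𝒢.trg g) := by
  rw [Atiyah.trg, Atiyah.proj_mk hi hj, Atiyah.coord_mk hi hj, Bisection.trg_leftMul,
    Bisection.trg_rightMul, ← Shadow.mk_eq hi (A.mem_indexAt σ₁)]

theorem Atiyah.unit_mk (hi : σ ∈ A.base i) (m : M) :
    Atiyah.unit (Shadow.mk A i σ m) = Atiyah.mk A i σ (𝒢.unit m) σ i := by
  rw [Atiyah.unit, Shadow.proj_mk hi, Shadow.coord_mk hi,
    Atiyah.mk_eq hi hi (A.mem_indexAt σ) (A.mem_indexAt σ),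
    ← cocycle_inv (A.mem_indexAt σ) hi, Bisection.leftMul_rightMul_unit]

theorem Atiyah.inv_mk (hi : σ₁ ∈ A.base i) (hj : σ₂ ∈ A.base j) (g : G) :
    Atiyah.inv (Atiyah.mk A i σ₁ g σ₂ j) = Atiyah.mk A j σ₂ (𝒢.inv g) σ₁ i := by
  rw [Atiyah.inv, Atiyah.proj_mk hi hj, Atiyah.coord_mk hi hj,
    Atiyah.mk_eq hj hi (A.mem_indexAt σ₂) (A.mem_indexAt σ₁), Bisection.inv_leftMul,
    Bisection.inv_rightMul, cocycle_inv hj (A.mem_indexAt σ₂),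
    cocycle_inv (A.mem_indexAt σ₁) hi, Bisection.leftMul_rightMul]

theorem Atiyah.mul_mk (hi : σ₁ ∈ A.base i) (hj : σ₂ ∈ A.base j) (hl : σ₃ ∈ A.base l) {g h : G}
    (e : 𝒢.src g = 𝒢.trg h) :
    Atiyah.mul (Atiyah.mk A i σ₁ g σ₂ j) (Atiyah.mk A j σ₂ h σ₃ l) =
      Atiyah.mk A i σ₁ (𝒢.mul g h) σ₃ l := by
  have e1 : 𝒢.src (Bisection.rightMul g (A.cocycle j (A.indexAt σ₂) σ₂)) =
      𝒢.trg ((A.cocycle (A.indexAt σ₂) j σ₂).leftMul h) := by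
    rw [Bisection.src_rightMul, Bisection.trg_leftMul, cocycle_inv hj (A.mem_indexAt σ₂), e]
  rw [Atiyah.mul, Atiyah.proj_mk hi hj, Atiyah.proj_mk hj hl, Atiyah.coord_mk hi hj,
    Atiyah.coord_mk hj hl, Atiyah.mk_eq hi hl (A.mem_indexAt σ₁) (A.mem_indexAt σ₃),
    ← Bisection.leftMul_mul _ (by rw [e1, Bisection.trg_leftMul, Bisection.trg_leftMul,
      Bisection.trg_rightMul]), Bisection.leftMul_rightMul, Bisection.mul_rightMul _ e1,
    ← cocycle_inv hj (A.mem_indexAt σ₂), Bisection.rightMul_mul_leftMul _ e]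

/-- The multiplication for representatives with different middle indices. -/
theorem Atiyah.mul_mk' (hi : σ₁ ∈ A.base i) (hj : σ₂ ∈ A.base j) (hk : σ₂ ∈ A.base k)
    (hl : σ₃ ∈ A.base l) {g h : G} (e : 𝒢.src g = 𝒢.trg ((A.cocycle j k σ₂).leftMul h)) :
    Atiyah.mul (Atiyah.mk A i σ₁ g σ₂ j) (Atiyah.mk A k σ₂ h σ₃ l) =
      Atiyah.mk A i σ₁ (𝒢.mul g ((A.cocycle j k σ₂).leftMul h)) σ₃ l := by
  rw [Atiyah.mk_eq hk hl hj hl h, cocycle_self hl, Bisection.rightMul_one, Atiyah.mul_mk hi hj hl e]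

theorem Shadow.mk_inj (hi : σ₁ ∈ A.base i) (hi' : σ₂ ∈ A.base i) {m n : M}
    (h : Shadow.mk A i σ₁ m = Shadow.mk A i σ₂ n) : σ₁ = σ₂ ∧ m = n := by
  have := congrArg (Glued.triv A.shadowCore i) h
  rw [Shadow.triv_mk hi, Shadow.triv_mk hi'] at this
  exact Prod.mk.inj this

/-- Composable pairs in normal form. -/
theorem Atiyah.composable {x y : A.Atiyah} (h : Atiyah.src x = Atiyah.trg y)
    (hj : (Atiyah.proj A y).1 ∈ A.base j) (hi : (Atiyah.proj A x).1 ∈ A.base i)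
    (hl : (Atiyah.proj A y).2 ∈ A.base l) :
    (Atiyah.proj A x).2 = (Atiyah.proj A y).1 ∧
    𝒢.src (Glued.triv A.atiyahCore (i, j) x).2 = 𝒢.trg (Glued.triv A.atiyahCore (j, l) y).2 := by
  have h0 : (Atiyah.proj A x).2 = (Atiyah.proj A y).1 := by
    have := congrArg (Shadow.proj A) h
    rwa [Atiyah.src, Atiyah.trg, Shadow.proj_mk_indexAt, Shadow.proj_mk_indexAt] at this
  have hj' : (Atiyah.proj A x).2 ∈ A.base j := by rwa [h0]
  rw [← Atiyah.mk_triv hi hj', ← Atiyah.mk_triv hj hl, Atiyah.src_mk hi hj',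
    Atiyah.trg_mk hj hl] at h
  exact ⟨h0, (Shadow.mk_inj hj' hj h).2⟩

theorem Atiyah.mul_eq {x y : A.Atiyah} (h : Atiyah.src x = Atiyah.trg y)
    (hj : (Atiyah.proj A y).1 ∈ A.base j) (hi : (Atiyah.proj A x).1 ∈ A.base i)
    (hl : (Atiyah.proj A y).2 ∈ A.base l) :
    Atiyah.mul x y = Atiyah.mk A i (Atiyah.proj A x).1 (𝒢.mul
      (Glued.triv A.atiyahCore (i, j) x).2 (Glued.triv A.atiyahCore (j, l) y).2)
      (Atiyah.proj A y).2 l := by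
  obtain ⟨h0, h1⟩ := Atiyah.composable h hj hi hl
  have hj' : (Atiyah.proj A x).2 ∈ A.base j := by rwa [h0]
  have hx := Atiyah.mk_triv hi hj'
  have hy := Atiyah.mk_triv hj hl
  rw [h0] at hx
  rw [← Atiyah.mul_mk hi hj hl h1, hx, hy]

end Classes

theorem Atiyah.composable' {x y : A.Atiyah} (h : Atiyah.src x = Atiyah.trg y) :
    (Atiyah.proj A x).2 = (Atiyah.proj A y).1 ∧
    𝒢.src (Atiyah.coord x) = 𝒢.trg (Atiyah.coord y) := by
  have h0 := Atiyah.composable h (A.mem_indexAt _) (A.mem_indexAt _) (A.mem_indexAt _)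
  refine ⟨h0.1, ?_⟩
  rw [Atiyah.coord, h0.1]
  exact h0.2

/-! Smoothness of the structure maps. -/

theorem Atiyah.isSubmersion_src :
    Manifold.IsSubmersion ((IS.prod IS).prod J) (IS.prod I) ∞
      (Atiyah.src : A.Atiyah → A.Shadow) := by
  refine Glued.isSubmersion_of_local (IS.prod IS) J IS I
    (φ := Prod.map Prod.snd 𝒢.src) ((isSubmersion_snd IS IS S S).prodMap 𝒢.isSubmersion_src)
    fun x => ⟨(A.indexAt (Atiyah.proj A x).1, A.indexAt (Atiyah.proj A x).2),
      A.indexAt (Atiyah.proj A x).2, ⟨A.mem_indexAt _, A.mem_indexAt _⟩, fun y hy => ?_⟩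
  obtain ⟨hi, hj⟩ : (Atiyah.proj A y).1 ∈ A.base (A.indexAt (Atiyah.proj A x).1) ∧
    (Atiyah.proj A y).2 ∈ A.base (A.indexAt (Atiyah.proj A x).2) := id hy
  have h := Atiyah.src_mk hi hj (Glued.triv A.atiyahCore
    (A.indexAt (Atiyah.proj A x).1, A.indexAt (Atiyah.proj A x).2) y).2
  rw [Atiyah.mk_triv hi hj] at h
  rw [h]
  refine ⟨?_, ?_⟩
  · rw [Glued.mem_triv_source]
    change Shadow.proj A _ ∈ A.base _
    rwa [Shadow.proj_mk hj]
  · rw [Shadow.triv_mk hj]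
    refine Prod.ext ?_ rfl
    exact congrArg (fun q : S × S => q.2) ((Glued.triv A.atiyahCore _).coe_fst hy).symm

theorem Atiyah.isSubmersion_trg :
    Manifold.IsSubmersion ((IS.prod IS).prod J) (IS.prod I) ∞
      (Atiyah.trg : A.Atiyah → A.Shadow) := by
  refine Glued.isSubmersion_of_local (IS.prod IS) J IS I
    (φ := Prod.map Prod.fst 𝒢.trg) ((isSubmersion_fst IS IS S S).prodMap 𝒢.isSubmersion_trg)
    fun x => ⟨(A.indexAt (Atiyah.proj A x).1, A.indexAt (Atiyah.proj A x).2),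
      A.indexAt (Atiyah.proj A x).1, ⟨A.mem_indexAt _, A.mem_indexAt _⟩, fun y hy => ?_⟩
  obtain ⟨hi, hj⟩ : (Atiyah.proj A y).1 ∈ A.base (A.indexAt (Atiyah.proj A x).1) ∧
    (Atiyah.proj A y).2 ∈ A.base (A.indexAt (Atiyah.proj A x).2) := id hy
  have h := Atiyah.trg_mk hi hj (Glued.triv A.atiyahCore
    (A.indexAt (Atiyah.proj A x).1, A.indexAt (Atiyah.proj A x).2) y).2
  rw [Atiyah.mk_triv hi hj] at h
  rw [h]
  refine ⟨?_, ?_⟩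
  · rw [Glued.mem_triv_source]
    change Shadow.proj A _ ∈ A.base _
    rwa [Shadow.proj_mk hi]
  · rw [Shadow.triv_mk hi]
    refine Prod.ext ?_ rfl
    exact congrArg (fun q : S × S => q.1) ((Glued.triv A.atiyahCore _).coe_fst hy).symm

theorem Shadow.contMDiff_proj : ContMDiff (IS.prod I) IS ∞ (Shadow.proj A) :=
  Glued.contMDiff_proj IS I

theorem Atiyah.contMDiff_proj :
    ContMDiff ((IS.prod IS).prod J) (IS.prod IS) ∞ (Atiyah.proj A) :=
  Glued.contMDiff_proj (IS.prod IS) J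

theorem Atiyah.contMDiff_unit :
    ContMDiff (IS.prod I) ((IS.prod IS).prod J) ∞ (Atiyah.unit : A.Shadow → A.Atiyah) := by
  intro x
  set i := A.indexAt (Shadow.proj A x)
  set s : Set A.Shadow := (Glued.triv A.shadowCore i).source
  have hs : s ∈ 𝓝 x := (Glued.triv A.shadowCore i).open_source.mem_nhds (A.mem_indexAt _)
  have h1 := Glued.contMDiffOn_triv IS I (Z := A.shadowCore) i
  have h2 := (Shadow.contMDiff_proj (A := A)).contMDiffOn (s := s)
  have h3 : ContMDiffOn (IS.prod I) J ∞
      (fun y => 𝒢.unit (Glued.triv A.shadowCore i y).2) s :=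
    𝒢.contMDiff_unit.comp_contMDiffOn (contMDiff_snd.comp_contMDiffOn h1)
  have h4 := (Glued.contMDiffOn_triv_symm (IS.prod IS) J (Z := A.atiyahCore) (i, i)).comp
    ((h2.prodMk h2).prodMk h3) (fun y hy => Glued.mem_triv_target.2 ⟨hy, hy⟩)
  refine (h4.contMDiffAt hs).congr_of_eventuallyEq ?_
  filter_upwards [hs] with y hy
  have hy' : Shadow.proj A y ∈ A.base i := hy
  have h := Atiyah.unit_mk hy' (Glued.triv A.shadowCore i y).2
  rw [Shadow.mk_triv hy'] at h
  exact h

theorem Atiyah.contMDiff_inv :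
    ContMDiff ((IS.prod IS).prod J) ((IS.prod IS).prod J) ∞
      (Atiyah.inv : A.Atiyah → A.Atiyah) := by
  intro x
  set i := A.indexAt (Atiyah.proj A x).1
  set j := A.indexAt (Atiyah.proj A x).2
  set s : Set A.Atiyah := (Glued.triv A.atiyahCore (i, j)).source
  have hs : s ∈ 𝓝 x := (Glued.triv A.atiyahCore (i, j)).open_source.mem_nhds
    ⟨A.mem_indexAt _, A.mem_indexAt _⟩
  have h1 := Glued.contMDiffOn_triv (IS.prod IS) J (Z := A.atiyahCore) (i, j)
  have h2 := (Atiyah.contMDiff_proj (A := A)).contMDiffOn (s := s)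
  have h3 : ContMDiffOn ((IS.prod IS).prod J) J ∞
      (fun y => 𝒢.inv (Glued.triv A.atiyahCore (i, j) y).2) s :=
    𝒢.contMDiff_inv.comp_contMDiffOn (contMDiff_snd.comp_contMDiffOn h1)
  have h4 := (Glued.contMDiffOn_triv_symm (IS.prod IS) J (Z := A.atiyahCore) (j, i)).comp
    (((contMDiff_snd.comp_contMDiffOn h2).prodMk
      (contMDiff_fst.comp_contMDiffOn h2)).prodMk h3)
    (fun y hy => Glued.mem_triv_target.2 ⟨hy.2, hy.1⟩)
  refine (h4.contMDiffAt hs).congr_of_eventuallyEq ?_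
  filter_upwards [hs] with y hy
  have hy1 : (Atiyah.proj A y).1 ∈ A.base i := hy.1
  have hy2 : (Atiyah.proj A y).2 ∈ A.base j := hy.2
  have h := Atiyah.inv_mk hy1 hy2
    (Glued.triv A.atiyahCore (i, j) y).2
  rw [Atiyah.mk_triv hy1 hy2] at h
  exact h

theorem Atiyah.contMDiffOn_mul :
    ContMDiffOn (((IS.prod IS).prod J).prod ((IS.prod IS).prod J)) ((IS.prod IS).prod J) ∞
      (fun p : A.Atiyah × A.Atiyah => Atiyah.mul p.1 p.2)
      {p | Atiyah.src p.1 = Atiyah.trg p.2} := by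
  intro p hp
  set i := A.indexAt (Atiyah.proj A p.1).1
  set j := A.indexAt (Atiyah.proj A p.2).1
  set l := A.indexAt (Atiyah.proj A p.2).2
  set c : Set (A.Atiyah × A.Atiyah) := {p | Atiyah.src p.1 = Atiyah.trg p.2}
  set o : Set (A.Atiyah × A.Atiyah) :=
    (Glued.triv A.atiyahCore (i, j)).source ×ˢ (Glued.triv A.atiyahCore (j, l)).source
  have ho : IsOpen o := (Glued.triv A.atiyahCore (i, j)).open_source.prod
    (Glued.triv A.atiyahCore (j, l)).open_source
  have hpo : p ∈ o := by
    have h0 := (Atiyah.composable hp (A.mem_indexAt _) (A.mem_indexAt _) (A.mem_indexAt _)).1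
    refine ⟨⟨A.mem_indexAt _, ?_⟩, A.mem_indexAt _, A.mem_indexAt _⟩
    change (Atiyah.proj A p.1).2 ∈ A.base _
    rw [h0]
    exact A.mem_indexAt _
  have h1 := (Glued.contMDiffOn_triv (IS.prod IS) J (Z := A.atiyahCore) (i, j)).comp
    (contMDiffOn_fst (I := (IS.prod IS).prod J) (J := (IS.prod IS).prod J) (s := c ∩ o))
    (fun q hq => hq.2.1)
  have h2 := (Glued.contMDiffOn_triv (IS.prod IS) J (Z := A.atiyahCore) (j, l)).comp
    (contMDiffOn_snd (I := (IS.prod IS).prod J) (J := (IS.prod IS).prod J) (s := c ∩ o))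
    (fun q hq => hq.2.2)
  have h3 := 𝒢.contMDiffOn_mul.comp ((contMDiff_snd.comp_contMDiffOn h1).prodMk
    (contMDiff_snd.comp_contMDiffOn h2)) (fun q hq =>
      (Atiyah.composable (A := A) (x := q.1) (y := q.2) (j := j) (i := i) (l := l) hq.1
        hq.2.2.1 hq.2.1.1 hq.2.2.2).2)
  have h4 : ContMDiffOn (((IS.prod IS).prod J).prod ((IS.prod IS).prod J)) (IS.prod IS) ∞
      (fun q : A.Atiyah × A.Atiyah => ((Atiyah.proj A q.1).1, (Atiyah.proj A q.2).2)) (c ∩ o) :=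
    ((contMDiff_fst.comp (Atiyah.contMDiff_proj.comp contMDiff_fst)).prodMk
      (contMDiff_snd.comp (Atiyah.contMDiff_proj.comp contMDiff_snd))).contMDiffOn
  have h5 := (Glued.contMDiffOn_triv_symm (IS.prod IS) J (Z := A.atiyahCore) (i, l)).comp
    (h4.prodMk h3) (fun q hq => Glued.mem_triv_target.2 ⟨hq.2.1.1, hq.2.2.2⟩)
  have h6 := h5.congr (f₁ := fun p : A.Atiyah × A.Atiyah => Atiyah.mul p.1 p.2)
    (fun q hq => Atiyah.mul_eq hq.1 hq.2.2.1 hq.2.1.1 hq.2.2.2)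
  exact (h6 p ⟨hp, hpo⟩).mono_of_mem_nhdsWithin
    (Filter.inter_mem self_mem_nhdsWithin (mem_nhdsWithin_of_mem_nhds (ho.mem_nhds hpo)))

variable (A)

/-- The Atiyah-Ehresmann groupoid `At(𝔓) ⇉ ℱ`. -/
def atiyahGroupoid :
    LieGroupoid (IS.prod I) ((IS.prod IS).prod J) A.Shadow A.Atiyah where
  src := Atiyah.src
  trg := Atiyah.trg
  unit := Atiyah.unit
  inv := Atiyah.inv
  mul := Atiyah.mul
  src_unit x := by
    rw [Atiyah.unit, Atiyah.src_mk (A.mem_indexAt _) (A.mem_indexAt _), 𝒢.src_unit,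
      Shadow.mk_coord]
  trg_unit x := by
    rw [Atiyah.unit, Atiyah.trg_mk (A.mem_indexAt _) (A.mem_indexAt _), 𝒢.trg_unit,
      Shadow.mk_coord]
  src_inv x := by
    rw [Atiyah.inv, Atiyah.src_mk (A.mem_indexAt _) (A.mem_indexAt _), 𝒢.src_inv, Atiyah.trg]
  trg_inv x := by
    rw [Atiyah.inv, Atiyah.trg_mk (A.mem_indexAt _) (A.mem_indexAt _), 𝒢.trg_inv, Atiyah.src]
  src_mul x y h := by
    have h1 := Atiyah.composable' h
    rw [Atiyah.mul, Atiyah.src_mk (A.mem_indexAt _) (A.mem_indexAt _), 𝒢.src_mul _ _ h1.2,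
      Atiyah.src]
  trg_mul x y h := by
    have h1 := Atiyah.composable' h
    rw [Atiyah.mul, Atiyah.trg_mk (A.mem_indexAt _) (A.mem_indexAt _), 𝒢.trg_mul _ _ h1.2,
      Atiyah.trg]
  mul_assoc x y z h h' := by
    have h1 := Atiyah.composable' h
    have h2 := Atiyah.composable' h'
    simp only [Atiyah.mul, Atiyah.proj_mk_indexAt, Atiyah.coord_mk_indexAt]
    rw [𝒢.mul_assoc _ _ _ h1.2 h2.2]
  unit_mul x := by
    simp only [Atiyah.mul, Atiyah.unit, Atiyah.trg, Shadow.proj_mk_indexAt,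
      Shadow.coord_mk_indexAt, Atiyah.proj_mk_indexAt, Atiyah.coord_mk_indexAt]
    rw [𝒢.unit_mul, Atiyah.mk_coord]
  mul_unit x := by
    simp only [Atiyah.mul, Atiyah.unit, Atiyah.src, Shadow.proj_mk_indexAt,
      Shadow.coord_mk_indexAt, Atiyah.proj_mk_indexAt, Atiyah.coord_mk_indexAt]
    rw [𝒢.mul_unit, Atiyah.mk_coord]
  inv_mul x := by
    simp only [Atiyah.mul, Atiyah.unit, Atiyah.inv, Atiyah.src, Shadow.proj_mk_indexAt,
      Shadow.coord_mk_indexAt, Atiyah.proj_mk_indexAt, Atiyah.coord_mk_indexAt]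
    rw [𝒢.inv_mul]
  mul_inv x := by
    simp only [Atiyah.mul, Atiyah.unit, Atiyah.inv, Atiyah.trg, Shadow.proj_mk_indexAt,
      Shadow.coord_mk_indexAt, Atiyah.proj_mk_indexAt, Atiyah.coord_mk_indexAt]
    rw [𝒢.mul_inv]
  isSubmersion_src := Atiyah.isSubmersion_src
  isSubmersion_trg := Atiyah.isSubmersion_trg
  contMDiff_unit := Atiyah.contMDiff_unit
  contMDiff_inv := Atiyah.contMDiff_inv
  contMDiffOn_mul := Atiyah.contMDiffOn_mul

end TrivializingCover

/-! ### Automorphisms and projectable bisections -/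

/-- A principaloid-bundle automorphism: an equivariant diffeomorphism of the total space which
covers a diffeomorphism of the base. -/
structure PrincipaloidAut (𝔓 : PrincipaloidBundle 𝒢 IP IS P S) where
  /-- the underlying diffeomorphism of the total space -/
  toDiffeo : Diffeomorph IP IP P P ∞
  moment_eq : ∀ p, 𝔓.moment (toDiffeo p) = 𝔓.moment p
  act_eq : ∀ p g, 𝔓.moment p = 𝒢.trg g → toDiffeo (𝔓.act p g) = 𝔓.act (toDiffeo p) g
  exists_base : ∃ f : Diffeomorph IS IS S S ∞, ∀ p, 𝔓.proj (toDiffeo p) = f (𝔓.proj p)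

namespace PrincipaloidAut

variable {𝔓 : PrincipaloidBundle 𝒢 IP IS P S}

instance : CoeFun (PrincipaloidAut 𝔓) (fun _ => P → P) := ⟨fun Φ => Φ.toDiffeo⟩

theorem ext_fun {Φ Ψ : PrincipaloidAut 𝔓} (h : ∀ p, Φ p = Ψ p) : Φ = Ψ := by
  obtain ⟨a, _, _, _⟩ := Φ
  obtain ⟨b, _, _, _⟩ := Ψ
  obtain rfl : a = b := Diffeomorph.ext h
  rfl

/-- The product of automorphisms is their composition. -/
instance : Mul (PrincipaloidAut 𝔓) where
  mul Φ Ψ :=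
    { toDiffeo := Ψ.toDiffeo.trans Φ.toDiffeo
      moment_eq := fun p => by
        rw [Diffeomorph.coe_trans, Function.comp_apply, Φ.moment_eq, Ψ.moment_eq]
      act_eq := fun p g h => by
        simp only [Diffeomorph.coe_trans, Function.comp_apply]
        rw [Ψ.act_eq p g h, Φ.act_eq _ g (by rw [Ψ.moment_eq, h])]
      exists_base := by
        obtain ⟨f, hf⟩ := Φ.exists_base
        obtain ⟨e, he⟩ := Ψ.exists_base
        refine ⟨e.trans f, fun p => ?_⟩
        simp only [Diffeomorph.coe_trans, Function.comp_apply]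
        rw [hf, he] }

instance : One (PrincipaloidAut 𝔓) where
  one :=
    { toDiffeo := Diffeomorph.refl IP P ∞
      moment_eq := fun _ => rfl
      act_eq := fun _ _ _ => rfl
      exists_base := ⟨Diffeomorph.refl IS S ∞, fun _ => rfl⟩ }

instance : Inv (PrincipaloidAut 𝔓) where
  inv Φ :=
    { toDiffeo := Φ.toDiffeo.symm
      moment_eq := fun p => by
        rw [← Φ.moment_eq (Φ.toDiffeo.symm p), Diffeomorph.apply_symm_apply]
      act_eq := fun p g h => by
        have h' : 𝔓.moment (Φ.toDiffeo.symm p) = 𝒢.trg g := by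
          rw [← Φ.moment_eq (Φ.toDiffeo.symm p), Diffeomorph.apply_symm_apply, h]
        rw [← Φ.toDiffeo.symm_apply_apply (𝔓.act (Φ.toDiffeo.symm p) g), Φ.act_eq _ g h',
          Diffeomorph.apply_symm_apply]
      exists_base := by
        obtain ⟨f, hf⟩ := Φ.exists_base
        refine ⟨f.symm, fun p => ?_⟩
        have := hf (Φ.toDiffeo.symm p)
        rw [Diffeomorph.apply_symm_apply] at this
        rw [this, Diffeomorph.symm_apply_apply] }

theorem mul_apply (Φ Ψ : PrincipaloidAut 𝔓) (p : P) : (Φ * Ψ) p = Φ (Ψ p) := rfl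

theorem one_apply (p : P) : (1 : PrincipaloidAut 𝔓) p = p := rfl

theorem inv_apply_self (Φ : PrincipaloidAut 𝔓) (p : P) : Φ⁻¹ (Φ p) = p :=
  Φ.toDiffeo.symm_apply_apply p

/-- The group `Aut(𝔓)` of principaloid-bundle automorphisms. -/
instance : Group (PrincipaloidAut 𝔓) where
  mul_assoc _ _ _ := rfl
  one_mul _ := ext_fun fun _ => rfl
  mul_one _ := ext_fun fun _ => rfl
  inv_mul_cancel Φ := ext_fun fun p => inv_apply_self Φ p

variable (𝔓) in
/-- The gauge group: the automorphisms which cover the identity of the base. -/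
def gauge : Subgroup (PrincipaloidAut 𝔓) where
  carrier := {Φ | ∀ p, 𝔓.proj (Φ p) = 𝔓.proj p}
  mul_mem' {Φ Ψ} hΦ hΨ p := by rw [mul_apply, hΦ, hΨ]
  one_mem' _ := rfl
  inv_mem' {Φ} hΦ p := by
    rw [← hΦ (Φ⁻¹ p)]
    exact congrArg 𝔓.proj (Φ.toDiffeo.apply_symm_apply p)

end PrincipaloidAut

namespace TrivializingCover

variable {𝔓 : PrincipaloidBundle 𝒢 IP IS P S} {ι : Type*} (A : TrivializingCover 𝔓 ι)

/-- The bisection `b` of the pair groupoid of the base is the projection of the bisection `β` of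
the Atiyah-Ehresmann groupoid: `π ∘ β = b ∘ π_ℱ`. -/
def ProjectsTo (β : Bisection A.atiyahGroupoid) (b : Bisection (pairGroupoid IS S)) : Prop :=
  ∀ x : A.Shadow, Atiyah.proj A (β x) = b (Shadow.proj A x)

variable {A}

theorem Atiyah.proj_trg (x : A.Atiyah) :
    Shadow.proj A (A.atiyahGroupoid.trg x) = (Atiyah.proj A x).1 := Shadow.proj_mk_indexAt _

theorem Atiyah.proj_mul (x y : A.Atiyah) : Atiyah.proj A (A.atiyahGroupoid.mul x y) =
    ((Atiyah.proj A x).1, (Atiyah.proj A y).2) := Atiyah.proj_mk_indexAt _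

theorem Atiyah.proj_inv (x : A.Atiyah) : Atiyah.proj A (A.atiyahGroupoid.inv x) =
    ((Atiyah.proj A x).2, (Atiyah.proj A x).1) := Atiyah.proj_mk_indexAt _

theorem ProjectsTo.mul {β γ : Bisection A.atiyahGroupoid} {b c : Bisection (pairGroupoid IS S)}
    (h : A.ProjectsTo β b) (h' : A.ProjectsTo γ c) : A.ProjectsTo (β * γ) (b * c) := by
  intro x
  rw [Bisection.mul_apply, Bisection.mul_apply, Atiyah.proj_mul, h, h', Atiyah.proj_trg, h']
  rfl

theorem ProjectsTo.one : A.ProjectsTo 1 1 := fun _ => Atiyah.proj_mk_indexAt _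

theorem ProjectsTo.inv {β : Bisection A.atiyahGroupoid} {b : Bisection (pairGroupoid IS S)}
    (h : A.ProjectsTo β b) : A.ProjectsTo β⁻¹ b⁻¹ := by
  intro x
  obtain ⟨y, rfl⟩ : ∃ y, β.shadow y = x := ⟨β.shadow.symm x, Diffeomorph.apply_symm_apply _ _⟩
  have h1 : Shadow.proj A (β.shadow y) = b.shadow (Shadow.proj A y) := by
    rw [Bisection.shadow_apply, Bisection.shadow_apply, Atiyah.proj_trg, h]
    rfl
  rw [Bisection.inv_apply, Bisection.inv_apply, Diffeomorph.symm_apply_apply, Atiyah.proj_inv, h,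
    h1, Diffeomorph.symm_apply_apply]
  rfl

variable (A)

/-- The group of projectable bisections of the Atiyah-Ehresmann groupoid. -/
def bisecProj : Subgroup (Bisection A.atiyahGroupoid) where
  carrier := {β | ∃ b, A.ProjectsTo β b}
  mul_mem' := fun ⟨b, hb⟩ ⟨c, hc⟩ => ⟨b * c, hb.mul hc⟩
  one_mem' := ⟨1, ProjectsTo.one⟩
  inv_mem' := fun ⟨b, hb⟩ => ⟨b⁻¹, hb.inv⟩

/-- The group of bisections which project to the identity bisection of the pair groupoid of the
base; these are the bisections with values in the adjoint bundle. -/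
def bisecAd : Subgroup A.bisecProj where
  carrier := {β | A.ProjectsTo β.1 1}
  mul_mem' := fun hb hc => by simpa using ProjectsTo.mul hb hc
  one_mem' := ProjectsTo.one
  inv_mem' := fun hb => by simpa using ProjectsTo.inv hb

end TrivializingCover

end PrincipaloidBundles

end Principaloid

end

/-! The theorem follows the pattern of the gauge groupoid of a principal bundle. Besides the right
action of `𝒢`, the total space carries a commuting left action of `At(𝔓)`, given in charts by
multiplication of arrows on the left. The shadow bundle is the orbit space of the right action:
right multiplication does not change targets, so `τᵢ⁻¹(σ, g) ↦ [(σ, t(g), i)]` (`toShadow`) is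
invariant, its fibres are single orbits (`toShadow_act`, `exists_act_eq`), and it has smooth local
sections.

The left action `leftAct` is along `toShadow`, preserves the moment map, and is free and transitive
on the fibres of the moment map: for `p`, `q` of equal moment, `division p q` is the unique arrow
starting at the class of `q` and carrying `q` to `p` (`leftAct_division`, `division_leftAct`).
Uniqueness and the commutation of the two actions make `division` invariant under the diagonal right
action (`division_act_act`).

A bisection `β` therefore acts on the total space by `p ↦ β([p]) . p`, and products of bisections
become compositions (`bisectionMap_mul`). Conversely, an automorphism `Φ` preserves moments, so the
arrow from `p` to `Φ(p)` exists; equivariance makes it depend only on `[p]`, and the local sections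
make the resulting map on the shadow bundle smooth. The two laws relating `leftAct` and `division`
say that these constructions are inverse to each other. Projectability of `β` is what makes the
induced map cover a diffeomorphism of the base, and projection to the identity bisection corresponds
to gauge transformations. The explicit formula comes from evaluating `division (Φ p) p` at `p =
τᵢ⁻¹(σ, Id_m)`. -/

namespace Principaloid

noncomputable section

variable {EM HM EG HG ES HS EP HP : Type*}
  [NormedAddCommGroup EM] [NormedSpace ℝ EM] [TopologicalSpace HM]
  [NormedAddCommGroup EG] [NormedSpace ℝ EG] [TopologicalSpace HG]
  [NormedAddCommGroup ES] [NormedSpace ℝ ES] [TopologicalSpace HS]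
  [NormedAddCommGroup EP] [NormedSpace ℝ EP] [TopologicalSpace HP]
  {I : ModelWithCorners ℝ EM HM} {J : ModelWithCorners ℝ EG HG}
  {IS : ModelWithCorners ℝ ES HS} {IP : ModelWithCorners ℝ EP HP}
  {M G S P : Type*}
  [TopologicalSpace M] [ChartedSpace HM M] [IsManifold I ∞ M]
  [TopologicalSpace G] [ChartedSpace HG G] [IsManifold J ∞ G]
  [TopologicalSpace S] [ChartedSpace HS S] [IsManifold IS ∞ S]
  [TopologicalSpace P] [ChartedSpace HP P] [IsManifold IP ∞ P]
  {𝒢 : LieGroupoid I J M G} {𝔓 : PrincipaloidBundle 𝒢 IP IS P S}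

namespace TrivializingCover

/-! ### Representatives in charts and smoothness of the chart maps. -/

variable {ι : Type*} {A : TrivializingCover 𝔓 ι} {i j : ι} {σ σ₁ σ₂ : S}

/-- Change of the index of a point of the total space. -/
theorem pt_eq_cocycle (hi : σ ∈ A.base i) (hj : σ ∈ A.base j) (g : G) :
    A.pt j σ g = A.pt i σ ((A.cocycle i j σ).leftMul g) := by
  rw [cocycle_leftMul hi hj, pt_trans hi hj]

/-- Hides the chosen index `indexAt` behind an existential, so that later arguments can use the
formulas valid for arbitrary representatives. -/
theorem exists_eq_pt (A : TrivializingCover 𝔓 ι) (p : P) :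
    ∃ i g, 𝔓.proj p ∈ A.base i ∧ p = A.pt i (𝔓.proj p) g :=
  ⟨_, _, A.mem_indexAt _, (pt_snd (A.mem_indexAt _)).symm⟩

theorem Atiyah.exists_eq_mk (x : A.Atiyah) :
    ∃ i j g, (Atiyah.proj A x).1 ∈ A.base i ∧ (Atiyah.proj A x).2 ∈ A.base j ∧
      x = Atiyah.mk A i (Atiyah.proj A x).1 g (Atiyah.proj A x).2 j :=
  ⟨_, _, _, A.mem_indexAt _, A.mem_indexAt _, (Atiyah.mk_coord x).symm⟩

theorem Shadow.exists_eq_mk (x : A.Shadow) :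
    ∃ i m, Shadow.proj A x ∈ A.base i ∧ x = Shadow.mk A i (Shadow.proj A x) m :=
  ⟨_, _, A.mem_indexAt _, (Shadow.mk_coord x).symm⟩

theorem contMDiffOn_pt (A : TrivializingCover 𝔓 ι) (i : ι) :
    ContMDiffOn (IS.prod J) IP ∞ (fun x : S × G => A.pt i x.1 x.2) (A.base i ×ˢ univ) :=
  (A.equivariant i).contMDiffOn_symm.mono fun _ hx => (A.triv i).mem_target.2 hx.1

theorem contMDiffOn_triv_snd (A : TrivializingCover 𝔓 ι) (i : ι) :
    ContMDiffOn IP J ∞ (fun p : P => (A.triv i p).2) (𝔓.proj ⁻¹' A.base i) :=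
  contMDiff_snd.comp_contMDiffOn ((A.equivariant i).contMDiffOn.mono
    fun _ hx => mem_source_of_proj_mem hx)

theorem contMDiff_bundle_proj (𝔓 : PrincipaloidBundle 𝒢 IP IS P S) :
    ContMDiff IP IS ∞ 𝔓.proj := 𝔓.isSubmersion_proj.contMDiff

theorem preimage_base_mem_nhds (A : TrivializingCover 𝔓 ι) (p : P) :
    𝔓.proj ⁻¹' A.base (A.indexAt (𝔓.proj p)) ∈ 𝓝 p :=
  ((A.isOpen_base _).preimage (contMDiff_bundle_proj 𝔓).continuous).mem_nhds (A.mem_indexAt _)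

theorem contMDiffOn_shadow_mk (A : TrivializingCover 𝔓 ι) (i : ι) :
    ContMDiffOn (IS.prod I) (IS.prod I) ∞ (fun x : S × M => Shadow.mk A i x.1 x.2)
      (A.base i ×ˢ univ) :=
  (Glued.contMDiffOn_triv_symm IS I (Z := A.shadowCore) i).mono
    fun _ hx => Glued.mem_triv_target.2 hx.1

theorem contMDiffOn_atiyah_mk (A : TrivializingCover 𝔓 ι) (i j : ι) :
    ContMDiffOn ((IS.prod IS).prod J) ((IS.prod IS).prod J) ∞
      (fun x : (S × S) × G => Atiyah.mk A i x.1.1 x.2 x.1.2 j)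
      ((A.base i ×ˢ A.base j) ×ˢ univ) :=
  (Glued.contMDiffOn_triv_symm (IS.prod IS) J (Z := A.atiyahCore) (i, j)).mono
    fun _ hx => Glued.mem_triv_target.2 hx.1

/-! ### The quotient map onto the shadow bundle -/

/-- The quotient map `τᵢ⁻¹(σ, g) ↦ [(σ, t(g), i)]` from the total space onto the shadow bundle. -/
def toShadow (A : TrivializingCover 𝔓 ι) (p : P) : A.Shadow :=
  Shadow.mk A (A.indexAt (𝔓.proj p)) (𝔓.proj p) (𝒢.trg (A.triv (A.indexAt (𝔓.proj p)) p).2)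

/-- Left multiplication by the cocycle moves targets by its shadow, which is precisely the gluing of
the shadow bundle; hence any trivialization computes the class. -/
theorem toShadow_pt (hi : σ ∈ A.base i) (g : G) :
    A.toShadow (A.pt i σ g) = Shadow.mk A i σ (𝒢.trg g) := by
  rw [toShadow, proj_pt hi, triv_pt_eq_cocycle (A.mem_indexAt σ) hi, Bisection.trg_leftMul,
    ← Shadow.mk_eq hi (A.mem_indexAt σ)]

theorem proj_toShadow (p : P) : Shadow.proj A (A.toShadow p) = 𝔓.proj p :=
  Shadow.proj_mk_indexAt _

/-- The right action changes only the source of the fibre coordinate. Together with `exists_act_eq`,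
this identifies the fibres with the orbits of `𝒢`. -/
theorem toShadow_act {p : P} {g : G} (h : 𝔓.moment p = 𝒢.trg g) :
    A.toShadow (𝔓.act p g) = A.toShadow p := by
  obtain ⟨i, a, hi, hp⟩ := A.exists_eq_pt p
  have e : 𝒢.src a = 𝒢.trg g := by rw [← h, hp, moment_pt hi]
  rw [hp, pt_act hi e, toShadow_pt hi, toShadow_pt hi, 𝒢.trg_mul _ _ e]

theorem toShadow_surjective : Function.Surjective A.toShadow := fun x => by
  obtain ⟨i, m, hi, hx⟩ := Shadow.exists_eq_mk x
  exact ⟨A.pt i _ (𝒢.unit m), by rw [toShadow_pt hi, 𝒢.trg_unit, ← hx]⟩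

theorem contMDiff_toShadow : ContMDiff IP (IS.prod I) ∞ A.toShadow := by
  intro p
  set i := A.indexAt (𝔓.proj p)
  have hs := A.preimage_base_mem_nhds p
  have h := (A.contMDiffOn_shadow_mk i).comp
    ((contMDiff_bundle_proj 𝔓).contMDiffOn.prodMk
      (𝒢.contMDiff_trg.comp_contMDiffOn (A.contMDiffOn_triv_snd i))) (fun q hq => ⟨hq, trivial⟩)
  -- The index in the definition of `toShadow` may jump with the point; near `p` it is frozen at
  -- `i`, which gives the same class by `toShadow_pt`.
  refine (h.contMDiffAt hs).congr_of_eventuallyEq ?_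
  filter_upwards [hs] with q hq
  conv_lhs => rw [← pt_snd (A := A) (i := i) hq, toShadow_pt hq]
  rfl

/-- A local section of the quotient map onto the shadow bundle, `[(σ, m, i)] ↦ τᵢ⁻¹(σ, Id_m)`. -/
def shadowSection (A : TrivializingCover 𝔓 ι) (i : ι) (x : A.Shadow) : P :=
  A.pt i (Shadow.proj A x) (𝒢.unit (Glued.triv A.shadowCore i x).2)

theorem toShadow_shadowSection {x : A.Shadow} (hi : Shadow.proj A x ∈ A.base i) :
    A.toShadow (A.shadowSection i x) = x := by
  rw [shadowSection, toShadow_pt hi, 𝒢.trg_unit, Shadow.mk_triv hi]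

theorem contMDiffOn_shadowSection (A : TrivializingCover 𝔓 ι) (i : ι) :
    ContMDiffOn (IS.prod I) IP ∞ (A.shadowSection i) (Shadow.proj A ⁻¹' A.base i) :=
  (A.contMDiffOn_pt i).comp (Shadow.contMDiff_proj.contMDiffOn.prodMk
    (𝒢.contMDiff_unit.comp_contMDiffOn (contMDiff_snd.comp_contMDiffOn
      (Glued.contMDiffOn_triv IS I (Z := A.shadowCore) i)))) (fun _ hx => ⟨hx, trivial⟩)

/-- A map on the shadow bundle is smooth if its composition with the quotient map is. -/
theorem contMDiff_of_comp_toShadow {E' H' N : Type*} [NormedAddCommGroup E'] [NormedSpace ℝ E']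
    [TopologicalSpace H'] {I' : ModelWithCorners ℝ E' H'} [TopologicalSpace N]
    [ChartedSpace H' N] {φ : A.Shadow → N}
    (h : ContMDiff IP I' ∞ (φ ∘ A.toShadow)) : ContMDiff (IS.prod I) I' ∞ φ := by
  intro x
  set i := A.indexAt (Shadow.proj A x)
  have hs : Shadow.proj A ⁻¹' A.base i ∈ 𝓝 x :=
    ((A.isOpen_base _).preimage (Shadow.contMDiff_proj (A := A)).continuous).mem_nhds
      (A.mem_indexAt _)
  -- Locally `φ` is its pullback to the total space composed with a smooth section of the quotient
  -- map.
  refine ((h.comp_contMDiffOn (A.contMDiffOn_shadowSection i)).contMDiffAt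
    hs).congr_of_eventuallyEq ?_
  filter_upwards [hs] with y hy
  exact congrArg φ (toShadow_shadowSection hy).symm

/-- Two points of the same fibre of the quotient map differ by an arrow. -/
theorem exists_act_eq {p q : P} (h : A.toShadow p = A.toShadow q) :
    ∃ g, 𝔓.moment p = 𝒢.trg g ∧ 𝔓.act p g = q := by
  obtain ⟨i, a, hi, hp⟩ := A.exists_eq_pt p
  have e0 : 𝔓.proj p = 𝔓.proj q := by rw [← proj_toShadow (A := A), h, proj_toShadow]
  have hi' := hi
  rw [e0] at hi'
  have hq := pt_snd (A := A) hi'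
  set b := (A.triv i q).2
  rw [e0] at hp
  rw [hp, ← hq, proj_pt hi', toShadow_pt hi', toShadow_pt hi'] at h
  have e := (Shadow.mk_inj hi' hi' h).2
  have e1 : 𝒢.src a = 𝒢.trg (𝒢.mul (𝒢.inv a) b) := by
    rw [𝒢.trg_mul _ _ (by rw [𝒢.src_inv, e]), 𝒢.trg_inv]
  -- In a common chart the coordinates `a` and `b` have the same target, so `a⁻¹ . b` is defined and
  -- carries `a` to `b`.
  refine ⟨𝒢.mul (𝒢.inv a) b, by rw [hp, moment_pt hi', e1], ?_⟩
  rw [hp, pt_act hi' e1, 𝒢.mul_inv_cancel_left e, hq]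

/-! ### The action of the Atiyah-Ehresmann groupoid on the total space -/

/-- The left action of the Atiyah-Ehresmann groupoid on the total space,
`[(σ₁, g, σ₂, i, j)] . τⱼ⁻¹(σ₂, h) = τᵢ⁻¹(σ₁, g . h)`. It is meaningful for arrows whose source is
the image of the point in the shadow bundle. -/
def leftAct (x : A.Atiyah) (p : P) : P :=
  A.pt (A.indexAt (Atiyah.proj A x).1) (Atiyah.proj A x).1
    (𝒢.mul (Atiyah.coord x) (A.triv (A.indexAt (Atiyah.proj A x).2) p).2)

/-- Independence of representatives: changing the chart over `σ₂` multiplies `g` on the right by a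
cocycle value and `h` on the left by its inverse, and the two cancel in the product. The change of
chart over `σ₁` is absorbed by `pt_eq_cocycle`. -/
theorem leftAct_mk (hi : σ₁ ∈ A.base i) (hj : σ₂ ∈ A.base j) {g h : G} (e : 𝒢.src g = 𝒢.trg h) :
    leftAct (Atiyah.mk A i σ₁ g σ₂ j) (A.pt j σ₂ h) = A.pt i σ₁ (𝒢.mul g h) := by
  have hk := A.mem_indexAt σ₁
  have hl := A.mem_indexAt σ₂
  have e1 : 𝒢.src (Bisection.rightMul g (A.cocycle j (A.indexAt σ₂) σ₂)) =
      𝒢.trg ((A.cocycle (A.indexAt σ₂) j σ₂).leftMul h) := by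
    rw [Bisection.src_rightMul, Bisection.trg_leftMul, cocycle_inv hj hl, e]
  rw [leftAct, Atiyah.proj_mk hi hj, Atiyah.coord_mk hi hj, triv_pt_eq_cocycle hl hj,
    ← Bisection.leftMul_mul _ e1, ← cocycle_inv hj hl, Bisection.rightMul_mul_leftMul _ e,
    ← pt_eq_cocycle hk hi]

/-- An arrow and a point which can be multiplied, in normal form. -/
theorem exists_normal_form {x : A.Atiyah} {p : P} (h : Atiyah.src x = A.toShadow p) :
    ∃ i j g a, (Atiyah.proj A x).1 ∈ A.base i ∧ (Atiyah.proj A x).2 ∈ A.base j ∧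
      𝒢.src g = 𝒢.trg a ∧ x = Atiyah.mk A i (Atiyah.proj A x).1 g (Atiyah.proj A x).2 j ∧
      p = A.pt j (Atiyah.proj A x).2 a := by
  obtain ⟨i, j, g, hi, hj, hx⟩ := Atiyah.exists_eq_mk x
  -- The point lies over the second base point of the arrow, so the same trivialization `j` serves
  -- for both.
  have e : (Atiyah.proj A x).2 = 𝔓.proj p := by
    rw [← proj_toShadow (A := A), ← h, Atiyah.src, Shadow.proj_mk_indexAt]
  have hp := pt_snd (A := A) (i := j) (p := p) (by rwa [← e])
  rw [← e] at hp
  refine ⟨i, j, g, _, hi, hj, ?_, hx, hp.symm⟩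
  rw [hx, ← hp, Atiyah.src_mk hi hj, toShadow_pt hj] at h
  exact (Shadow.mk_inj hj hj h).2

section LeftAct

variable {x : A.Atiyah} {p : P}

theorem proj_leftAct (x : A.Atiyah) (p : P) : 𝔓.proj (leftAct x p) = (Atiyah.proj A x).1 :=
  proj_pt (A.mem_indexAt _) _

theorem moment_leftAct (h : Atiyah.src x = A.toShadow p) :
    𝔓.moment (leftAct x p) = 𝔓.moment p := by
  obtain ⟨i, j, g, a, hi, hj, e, hx, hp⟩ := exists_normal_form h
  rw [hx, hp, leftAct_mk hi hj e, moment_pt hi, moment_pt hj, 𝒢.src_mul _ _ e]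

theorem toShadow_leftAct (h : Atiyah.src x = A.toShadow p) :
    A.toShadow (leftAct x p) = Atiyah.trg x := by
  obtain ⟨i, j, g, a, hi, hj, e, hx, hp⟩ := exists_normal_form h
  rw [hx, hp, leftAct_mk hi hj e, toShadow_pt hi, 𝒢.trg_mul _ _ e, Atiyah.trg_mk hi hj]

/-- In charts the two actions are left and right multiplication in `𝒢`, so they commute by
associativity. -/
theorem leftAct_act (h : Atiyah.src x = A.toShadow p) {g : G} (hg : 𝔓.moment p = 𝒢.trg g) :
    leftAct x (𝔓.act p g) = 𝔓.act (leftAct x p) g := by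
  obtain ⟨i, j, b, a, hi, hj, e, hx, hp⟩ := exists_normal_form h
  have e' : 𝒢.src a = 𝒢.trg g := by rw [← hg, hp, moment_pt hj]
  rw [hx, hp, pt_act hj e', leftAct_mk hi hj e, leftAct_mk hi hj (by rw [e, 𝒢.trg_mul _ _ e']),
    pt_act hi (by rw [𝒢.src_mul _ _ e, e']), 𝒢.mul_assoc _ _ _ e e']

theorem leftAct_unit (p : P) : leftAct (Atiyah.unit (A.toShadow p)) p = p := by
  obtain ⟨i, a, hi, hp⟩ := A.exists_eq_pt p
  rw [hp, toShadow_pt hi, Atiyah.unit_mk hi, leftAct_mk hi hi (𝒢.src_unit _), 𝒢.unit_mul]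

theorem leftAct_mul {y : A.Atiyah} (hy : Atiyah.src y = A.toShadow p)
    (h : Atiyah.src x = Atiyah.trg y) :
    leftAct (Atiyah.mul x y) p = leftAct x (leftAct y p) := by
  obtain ⟨i, j, g, a, hi, hj, e, hy', hp⟩ := exists_normal_form hy
  have h1 : leftAct y p = A.pt i (Atiyah.proj A y).1 (𝒢.mul g a) := by
    conv_lhs => rw [hy', hp, leftAct_mk hi hj e]
  have e0 := (Atiyah.composable h hi (A.mem_indexAt _) hj).1
  have hk : (Atiyah.proj A x).1 ∈ A.base (A.indexAt (Atiyah.proj A x).1) := A.mem_indexAt _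
  -- The arrow `x` is rewritten with the index `i` already used for the target of `y`, so that the
  -- two arrows multiply without a cocycle factor in between.
  have hx := Atiyah.mk_triv (x := x) hk (show (Atiyah.proj A x).2 ∈ A.base i by rwa [e0])
  set b := (Glued.triv A.atiyahCore (A.indexAt (Atiyah.proj A x).1, i) x).2
  have e1 : 𝒢.src b = 𝒢.trg g := by
    rw [(Atiyah.composable h hi hk hj).2]
    conv_lhs => rw [hy', Atiyah.triv_mk hi hj]
  rw [e0] at hx
  rw [h1, hp, ← hx, leftAct_mk hk hi (by rw [e1, 𝒢.trg_mul _ _ e]), hy', Atiyah.proj_mk hi hj,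
    Atiyah.mul_mk hk hi hj e1, leftAct_mk hk hj (by rw [𝒢.src_mul _ _ e1, e]),
    𝒢.mul_assoc _ _ _ e1 e]

/-- Near a given pair the indices can be frozen, after which the action is multiplication in `𝒢`
between smooth charts. Smoothness is only claimed within the set of composable pairs. -/
theorem contMDiffOn_leftAct :
    ContMDiffOn (((IS.prod IS).prod J).prod IP) IP ∞
      (fun y : A.Atiyah × P => leftAct y.1 y.2) {y | Atiyah.src y.1 = A.toShadow y.2} := by
  intro y hy
  set i := A.indexAt (Atiyah.proj A y.1).1
  set j := A.indexAt (Atiyah.proj A y.1).2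
  set c : Set (A.Atiyah × P) := {y | Atiyah.src y.1 = A.toShadow y.2}
  have hc : ∀ z ∈ c, (Atiyah.proj A z.1).2 = 𝔓.proj z.2 := fun z hz => by
    rw [← proj_toShadow (A := A), ← hz, Atiyah.src, Shadow.proj_mk_indexAt]
  set o : Set (A.Atiyah × P) := (Glued.triv A.atiyahCore (i, j)).source ×ˢ univ
  have ho : IsOpen o := (Glued.triv A.atiyahCore (i, j)).open_source.prod isOpen_univ
  have hyo : y ∈ o := ⟨⟨A.mem_indexAt _, A.mem_indexAt _⟩, trivial⟩
  have key : ∀ z ∈ c ∩ o, 𝒢.src (Glued.triv A.atiyahCore (i, j) z.1).2 =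
      𝒢.trg (A.triv j z.2).2 ∧ leftAct z.1 z.2 = A.pt i (Atiyah.proj A z.1).1
        (𝒢.mul (Glued.triv A.atiyahCore (i, j) z.1).2 (A.triv j z.2).2) := by
    rintro z ⟨hz, hzo⟩
    obtain ⟨hi, hj⟩ : (Atiyah.proj A z.1).1 ∈ A.base i ∧ (Atiyah.proj A z.1).2 ∈ A.base j := hzo.1
    have hx := Atiyah.mk_triv (x := z.1) hi hj
    have hp := pt_snd (A := A) (i := j) (p := z.2) (by rwa [← hc z hz])
    rw [← hc z hz] at hp
    have e : 𝒢.src (Glued.triv A.atiyahCore (i, j) z.1).2 = 𝒢.trg (A.triv j z.2).2 := by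
      have hz' : Atiyah.src z.1 = A.toShadow z.2 := hz
      rw [← hx, ← hp, Atiyah.src_mk hi hj, toShadow_pt hj] at hz'
      exact (Shadow.mk_inj hj hj hz').2
    refine ⟨e, ?_⟩
    conv_lhs => rw [← hx, ← hp, leftAct_mk hi hj e]
  have h1 := (Glued.contMDiffOn_triv (IS.prod IS) J (Z := A.atiyahCore) (i, j)).comp
    (contMDiffOn_fst (I := (IS.prod IS).prod J) (J := IP) (s := c ∩ o)) (fun q hq => hq.2.1)
  have h2 := (A.contMDiffOn_triv_snd j).comp
    (contMDiffOn_snd (I := (IS.prod IS).prod J) (J := IP) (s := c ∩ o)) (fun q hq => by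
      change 𝔓.proj q.2 ∈ A.base j
      rw [← hc q hq.1]
      exact hq.2.1.2)
  have h3 := 𝒢.contMDiffOn_mul.comp ((contMDiff_snd.comp_contMDiffOn h1).prodMk h2)
    (fun q hq => (key q hq).1)
  have h4 : ContMDiffOn (((IS.prod IS).prod J).prod IP) IS ∞
      (fun q : A.Atiyah × P => (Atiyah.proj A q.1).1) (c ∩ o) :=
    (contMDiff_fst.comp (Atiyah.contMDiff_proj.comp contMDiff_fst)).contMDiffOn
  have h5 := ((A.contMDiffOn_pt i).comp (h4.prodMk h3) (fun q hq => ⟨hq.2.1.1, trivial⟩)).congr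
    (fun q hq => (key q hq).2)
  -- Intersecting with the open set `o` does not change neighbourhoods of `y` within the composable
  -- pairs.
  exact (h5 y ⟨hy, hyo⟩).mono_of_mem_nhdsWithin
    (Filter.inter_mem self_mem_nhdsWithin (mem_nhdsWithin_of_mem_nhds (ho.mem_nhds hyo)))

end LeftAct

/-! ### The division map -/

/-- The arrow of the Atiyah-Ehresmann groupoid from the class of `q` to the class of `p` which maps
`q` to `p`. It is meaningful for points with the same moment. -/
def division (A : TrivializingCover 𝔓 ι) (p q : P) : A.Atiyah :=
  Atiyah.mk A (A.indexAt (𝔓.proj p)) (𝔓.proj p)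
    (𝒢.mul (A.triv (A.indexAt (𝔓.proj p)) p).2 (𝒢.inv (A.triv (A.indexAt (𝔓.proj q)) q).2))
    (𝔓.proj q) (A.indexAt (𝔓.proj q))

/-- A change of charts multiplies `g` and `h` on the left by cocycle values; inversion turns the
second into a right multiplication, giving the two-sided gluing of `At(𝔓)`. -/
theorem division_pt (hi : σ₁ ∈ A.base i) (hj : σ₂ ∈ A.base j) {g h : G}
    (e : 𝒢.src g = 𝒢.src h) : A.division (A.pt i σ₁ g) (A.pt j σ₂ h) =
      Atiyah.mk A i σ₁ (𝒢.mul g (𝒢.inv h)) σ₂ j := by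
  have hk := A.mem_indexAt σ₁
  have hl := A.mem_indexAt σ₂
  have e' : 𝒢.src g = 𝒢.trg (𝒢.inv h) := by rw [e, 𝒢.trg_inv]
  rw [division, proj_pt hi, proj_pt hj, triv_pt_eq_cocycle hk hi, triv_pt_eq_cocycle hl hj,
    Atiyah.mk_eq hi hj hk hl, Bisection.inv_leftMul, cocycle_inv hl hj,
    Bisection.mul_rightMul _ (by rw [Bisection.src_leftMul, e']), ← Bisection.leftMul_mul _ e',
    Bisection.leftMul_rightMul]

section Division

variable {p q : P}

theorem proj_division (p q : P) : Atiyah.proj A (A.division p q) = (𝔓.proj p, 𝔓.proj q) :=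
  Atiyah.proj_mk_indexAt _

/-- Two points of the same moment, in normal form. -/
theorem exists_pt_pt (A : TrivializingCover 𝔓 ι) (h : 𝔓.moment p = 𝔓.moment q) :
    ∃ i j a b, 𝔓.proj p ∈ A.base i ∧ 𝔓.proj q ∈ A.base j ∧ 𝒢.src a = 𝒢.src b ∧
      p = A.pt i (𝔓.proj p) a ∧ q = A.pt j (𝔓.proj q) b := by
  obtain ⟨i, a, hi, hp⟩ := A.exists_eq_pt p
  obtain ⟨j, b, hj, hq⟩ := A.exists_eq_pt q
  refine ⟨i, j, a, b, hi, hj, ?_, hp, hq⟩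
  rwa [hp, hq, moment_pt hi, moment_pt hj] at h

theorem src_division (h : 𝔓.moment p = 𝔓.moment q) :
    Atiyah.src (A.division p q) = A.toShadow q := by
  obtain ⟨i, j, a, b, hi, hj, e, hp, hq⟩ := A.exists_pt_pt h
  rw [hp, hq, division_pt hi hj e, Atiyah.src_mk hi hj, toShadow_pt hj,
    𝒢.src_mul _ _ (by rw [e, 𝒢.trg_inv]), 𝒢.src_inv]

theorem trg_division (h : 𝔓.moment p = 𝔓.moment q) :
    Atiyah.trg (A.division p q) = A.toShadow p := by
  obtain ⟨i, j, a, b, hi, hj, e, hp, hq⟩ := A.exists_pt_pt h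
  rw [hp, hq, division_pt hi hj e, Atiyah.trg_mk hi hj, toShadow_pt hi,
    𝒢.trg_mul _ _ (by rw [e, 𝒢.trg_inv])]

/-- Transitivity of the left action on the fibres of the moment map: in charts, `(a . b⁻¹) . b = a`.
-/
theorem leftAct_division (h : 𝔓.moment p = 𝔓.moment q) : leftAct (A.division p q) q = p := by
  obtain ⟨i, j, a, b, hi, hj, e, hp, hq⟩ := A.exists_pt_pt h
  have e1 : 𝒢.src a = 𝒢.trg (𝒢.inv b) := by rw [e, 𝒢.trg_inv]
  rw [hp, hq, division_pt hi hj e, leftAct_mk hi hj (by rw [𝒢.src_mul _ _ e1, 𝒢.src_inv]),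
    𝒢.mul_assoc _ _ _ e1 (𝒢.src_inv b), 𝒢.inv_mul, ← e, 𝒢.mul_unit]

/-- Freeness of the left action: an arrow is recovered from a point and its image, since `(g . a) .
a⁻¹ = g` in charts. -/
theorem division_leftAct {x : A.Atiyah} (h : Atiyah.src x = A.toShadow q) :
    A.division (leftAct x q) q = x := by
  obtain ⟨i, j, g, a, hi, hj, e, hx, hq⟩ := exists_normal_form h
  conv_lhs => rw [hx, hq, leftAct_mk hi hj e, division_pt hi hj (𝒢.src_mul _ _ e),
    𝒢.mul_inv_cancel_right e]
  exact hx.symm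

/-- The arrow carrying `q` to `p` also carries `q . g` to `p . g` because the actions commute;
freeness leaves no other candidate. -/
theorem division_act_act (h : 𝔓.moment p = 𝔓.moment q) {g : G} (hg : 𝔓.moment q = 𝒢.trg g) :
    A.division (𝔓.act p g) (𝔓.act q g) = A.division p q := by
  have h1 := src_division (A := A) h
  conv_lhs => rw [← leftAct_division (A := A) h, ← leftAct_act h1 hg]
  exact division_leftAct (by rw [h1, toShadow_act hg])

/-- With indices frozen near a pair, the fibre coordinate is `(a, b) ↦ a . b⁻¹`, smooth on pairs of
arrows with equal source. -/
theorem contMDiffOn_division :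
    ContMDiffOn (IP.prod IP) ((IS.prod IS).prod J) ∞
      (fun y : P × P => A.division y.1 y.2) {y | 𝔓.moment y.1 = 𝔓.moment y.2} := by
  intro y hy
  set i := A.indexAt (𝔓.proj y.1)
  set j := A.indexAt (𝔓.proj y.2)
  set c : Set (P × P) := {y | 𝔓.moment y.1 = 𝔓.moment y.2}
  set o : Set (P × P) := (𝔓.proj ⁻¹' A.base i) ×ˢ (𝔓.proj ⁻¹' A.base j)
  have ho : o ∈ 𝓝 y := prod_mem_nhds (A.preimage_base_mem_nhds y.1) (A.preimage_base_mem_nhds y.2)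
  have key : ∀ z ∈ c ∩ o, 𝒢.src (A.triv i z.1).2 = 𝒢.src (A.triv j z.2).2 := by
    rintro z ⟨hz, hi, hj⟩
    rw [← (A.equivariant i).moment_eq _ (mem_source_of_proj_mem hi),
      ← (A.equivariant j).moment_eq _ (mem_source_of_proj_mem hj)]
    exact hz
  have h1 := (A.contMDiffOn_triv_snd i).comp
    (contMDiffOn_fst (I := IP) (J := IP) (s := c ∩ o)) (fun q hq => hq.2.1)
  have h2 := (A.contMDiffOn_triv_snd j).comp
    (contMDiffOn_snd (I := IP) (J := IP) (s := c ∩ o)) (fun q hq => hq.2.2)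
  have h3 := 𝒢.contMDiffOn_mul.comp (h1.prodMk (𝒢.contMDiff_inv.comp_contMDiffOn h2))
    (fun q hq => (key q hq).trans (𝒢.trg_inv _).symm)
  have h4 : ContMDiffOn (IP.prod IP) (IS.prod IS) ∞
      (fun q : P × P => (𝔓.proj q.1, 𝔓.proj q.2)) (c ∩ o) :=
    (((contMDiff_bundle_proj 𝔓).comp contMDiff_fst).prodMk
      ((contMDiff_bundle_proj 𝔓).comp contMDiff_snd)).contMDiffOn
  have h5 := ((A.contMDiffOn_atiyah_mk i j).comp (h4.prodMk h3)
    (fun q hq => ⟨hq.2, trivial⟩)).congr (f₁ := fun y : P × P => A.division y.1 y.2)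
    (fun q hq => by
      conv_lhs => rw [← pt_snd (A := A) (p := q.1) hq.2.1, ← pt_snd (A := A) (p := q.2) hq.2.2,
        division_pt hq.2.1 hq.2.2 (key q hq)]
      rfl)
  exact (h5 y ⟨hy, mem_of_mem_nhds ho⟩).mono_of_mem_nhdsWithin
    (Filter.inter_mem self_mem_nhdsWithin (mem_nhdsWithin_of_mem_nhds ho))

end Division

/-! ### From bisections to automorphisms -/

/-- The left multiplication of the total space by a bisection of the Atiyah-Ehresmann groupoid. -/
def bisectionMap (β : Bisection A.atiyahGroupoid) (p : P) : P := leftAct (β (A.toShadow p)) p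

theorem src_bisection_toShadow (β : Bisection A.atiyahGroupoid) (p : P) :
    Atiyah.src (β (A.toShadow p)) = A.toShadow p := β.src_apply _

/-- On orbits of `𝒢`, left multiplication by `β` induces the shadow of `β`. -/
theorem toShadow_bisectionMap (β : Bisection A.atiyahGroupoid) (p : P) :
    A.toShadow (bisectionMap β p) = Atiyah.trg (β (A.toShadow p)) :=
  toShadow_leftAct (src_bisection_toShadow β p)

/-- The product evaluates `β` at the target of `γ([p])`, which is the class of the already moved
point; the rest is the action law `leftAct_mul`. Invertibility of `bisectionMap β` follows from this
formally. -/
theorem bisectionMap_mul (β γ : Bisection A.atiyahGroupoid) (p : P) :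
    bisectionMap (β * γ) p = bisectionMap β (bisectionMap γ p) := by
  rw [bisectionMap, bisectionMap, toShadow_bisectionMap]
  exact leftAct_mul (src_bisection_toShadow γ p) (β.src_apply _)

theorem bisectionMap_one (p : P) : bisectionMap (1 : Bisection A.atiyahGroupoid) p = p :=
  leftAct_unit p

theorem contMDiff_bisectionMap (β : Bisection A.atiyahGroupoid) :
    ContMDiff IP IP ∞ (bisectionMap β) := by
  have h : ContMDiff IP (((IS.prod IS).prod J).prod IP) ∞ (fun p : P => (β (A.toShadow p), p)) :=
    (β.contMDiff_toFun.comp contMDiff_toShadow).prodMk contMDiff_id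
  have h' := (contMDiffOn_leftAct (A := A)).comp (h.contMDiffOn (s := univ))
    fun p _ => src_bisection_toShadow β p
  rw [← contMDiffOn_univ]
  exact h'

/-- The automorphism of a principaloid bundle defined by a projectable bisection of its
Atiyah-Ehresmann groupoid. -/
def autOfBisection (β : A.bisecProj) : PrincipaloidAut 𝔓 where
  toDiffeo :=
    { toFun := bisectionMap β.1
      invFun := bisectionMap β.1⁻¹
      left_inv := fun p => by rw [← bisectionMap_mul, inv_mul_cancel, bisectionMap_one]
      right_inv := fun p => by rw [← bisectionMap_mul, mul_inv_cancel, bisectionMap_one]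
      contMDiff_toFun := contMDiff_bisectionMap _
      contMDiff_invFun := contMDiff_bisectionMap _ }
  moment_eq p := moment_leftAct (src_bisection_toShadow β.1 p)
  act_eq p g h := by
    change leftAct (β.1 (A.toShadow (𝔓.act p g))) (𝔓.act p g) = _
    rw [toShadow_act h]
    exact leftAct_act (src_bisection_toShadow β.1 p) h
  exists_base := by
    obtain ⟨b, hb⟩ := β.2
    -- The base point of the image is the first component of `π(β([p]))`; projectability makes it
    -- depend on the base point of `p` alone.
    refine ⟨b.shadow, fun p => (proj_leftAct (β.1 (A.toShadow p)) p).trans ?_⟩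
    rw [Bisection.shadow_apply, hb, proj_toShadow]
    rfl

theorem autOfBisection_apply (β : A.bisecProj) (p : P) :
    autOfBisection β p = leftAct (β.1 (A.toShadow p)) p := rfl

/-! ### From automorphisms to bisections -/

/-- The arrow `[Φ(q), q]` of the Atiyah-Ehresmann groupoid, for any point `q` over the given point
of the shadow bundle. -/
def autArrow (A : TrivializingCover 𝔓 ι) (Φ : PrincipaloidAut 𝔓) (x : A.Shadow) : A.Atiyah :=
  A.division (Φ (A.shadowSection (A.indexAt (Shadow.proj A x)) x))
    (A.shadowSection (A.indexAt (Shadow.proj A x)) x)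

/-- Any `p` over the given class may replace the chosen section: it differs from it by the right
action of some `g`, `Φ` is equivariant, and `division` ignores simultaneous right translation. -/
theorem autArrow_toShadow (Φ : PrincipaloidAut 𝔓) (p : P) :
    A.autArrow Φ (A.toShadow p) = A.division (Φ p) p := by
  have h := toShadow_shadowSection (A.mem_indexAt (Shadow.proj A (A.toShadow p)))
  rw [autArrow]
  obtain ⟨g, hg, hp⟩ := exists_act_eq h
  rw [← division_act_act (Φ.moment_eq _) hg, ← Φ.act_eq _ _ hg, hp]

theorem src_autArrow (Φ : PrincipaloidAut 𝔓) (x : A.Shadow) :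
    Atiyah.src (A.autArrow Φ x) = x := by
  obtain ⟨p, rfl⟩ := toShadow_surjective x
  rw [autArrow_toShadow, src_division (Φ.moment_eq p)]

theorem trg_autArrow (Φ : PrincipaloidAut 𝔓) (p : P) :
    Atiyah.trg (A.autArrow Φ (A.toShadow p)) = A.toShadow (Φ p) := by
  rw [autArrow_toShadow, trg_division (Φ.moment_eq p)]

/-- The chosen section depends on a possibly discontinuous index, so smoothness is checked after
pulling back to the total space, where the map is `p ↦ division (Φ p) p`. -/
theorem contMDiff_autArrow (Φ : PrincipaloidAut 𝔓) :
    ContMDiff (IS.prod I) ((IS.prod IS).prod J) ∞ (A.autArrow Φ) := by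
  refine contMDiff_of_comp_toShadow ?_
  have h := Φ.toDiffeo.contMDiff.prodMk (contMDiff_id (I := IP) (M := P))
  rw [← contMDiffOn_univ] at h ⊢
  exact (contMDiffOn_division.comp h fun p _ => Φ.moment_eq p).congr
    fun p _ => autArrow_toShadow Φ p

/-- On classes, the target map of `autArrow Φ` is the map induced by `Φ`; hence `Φ⁻¹` provides its
inverse and the bisection condition. -/
theorem trg_autArrow_inv (Φ : PrincipaloidAut 𝔓) (x : A.Shadow) :
    Atiyah.trg (A.autArrow Φ⁻¹ (Atiyah.trg (A.autArrow Φ x))) = x := by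
  obtain ⟨p, rfl⟩ := toShadow_surjective x
  rw [trg_autArrow, trg_autArrow, PrincipaloidAut.inv_apply_self]

/-- The bisection of the Atiyah-Ehresmann groupoid defined by an automorphism. -/
def bisectionOfAut (A : TrivializingCover 𝔓 ι) (Φ : PrincipaloidAut 𝔓) :
    Bisection A.atiyahGroupoid where
  toFun := A.autArrow Φ
  contMDiff_toFun := contMDiff_autArrow Φ
  src_toFun := src_autArrow Φ
  exists_diffeomorph := ⟨
    { toFun := fun x => Atiyah.trg (A.autArrow Φ x)
      invFun := fun x => Atiyah.trg (A.autArrow Φ⁻¹ x)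
      left_inv := trg_autArrow_inv Φ
      right_inv := fun x => by simpa using trg_autArrow_inv (A := A) Φ⁻¹ x
      contMDiff_toFun := A.atiyahGroupoid.contMDiff_trg.comp (contMDiff_autArrow Φ)
      contMDiff_invFun := A.atiyahGroupoid.contMDiff_trg.comp (contMDiff_autArrow Φ⁻¹) },
    fun _ => rfl⟩

theorem bisectionOfAut_apply_toShadow (Φ : PrincipaloidAut 𝔓) (p : P) :
    A.bisectionOfAut Φ (A.toShadow p) = A.division (Φ p) p := autArrow_toShadow Φ p

/-- The bisection `σ ↦ (f(σ), σ)` of the pair groupoid defined by a diffeomorphism `f`. -/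
def pairBisection (f : Diffeomorph IS IS S S ∞) : Bisection (pairGroupoid IS S) where
  toFun σ := (f σ, σ)
  contMDiff_toFun := f.contMDiff.prodMk contMDiff_id
  src_toFun _ := rfl
  exists_diffeomorph := ⟨f, fun _ => rfl⟩

theorem bisectionOfAut_mem_bisecProj (Φ : PrincipaloidAut 𝔓) :
    A.bisectionOfAut Φ ∈ A.bisecProj := by
  obtain ⟨f, hf⟩ := Φ.exists_base
  refine ⟨pairBisection f, fun x => ?_⟩
  obtain ⟨p, rfl⟩ := toShadow_surjective x
  rw [bisectionOfAut_apply_toShadow, proj_division, hf, proj_toShadow]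
  rfl

/-- The group isomorphism between the projectable bisections of the Atiyah-Ehresmann groupoid and
the automorphisms of the principaloid bundle. -/
def bisecProjEquivAut (A : TrivializingCover 𝔓 ι) : A.bisecProj ≃* PrincipaloidAut 𝔓 where
  toFun := autOfBisection
  invFun Φ := ⟨A.bisectionOfAut Φ, bisectionOfAut_mem_bisecProj Φ⟩
  -- Freeness of the left action recovers `β`; `right_inv` below is transitivity.
  left_inv β := Subtype.ext <| Bisection.ext_fun fun x => by
    obtain ⟨p, rfl⟩ := toShadow_surjective x
    rw [bisectionOfAut_apply_toShadow, autOfBisection_apply,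
      division_leftAct (src_bisection_toShadow β.1 p)]
  right_inv Φ := PrincipaloidAut.ext_fun fun p => by
    rw [autOfBisection_apply, bisectionOfAut_apply_toShadow, leftAct_division (Φ.moment_eq p)]
  map_mul' β γ := PrincipaloidAut.ext_fun fun p => bisectionMap_mul β.1 γ.1 p

/-- Only the first component of `π ∘ β` carries a condition, and it is the base point of the moved
point. -/
theorem autOfBisection_mem_gauge_iff (β : A.bisecProj) :
    autOfBisection β ∈ PrincipaloidAut.gauge 𝔓 ↔ β ∈ A.bisecAd := by
  have h1 : ∀ p, 𝔓.proj (autOfBisection β p) = (Atiyah.proj A (β.1 (A.toShadow p))).1 :=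
    fun p => proj_leftAct _ _
  constructor
  · intro h x
    obtain ⟨p, rfl⟩ := toShadow_surjective x
    refine Prod.ext ?_ ?_
    · rw [← h1, h p, proj_toShadow]
      rfl
    -- The second component is automatic because `β` is a section of the source map.
    · have := congrArg (Shadow.proj A) (src_bisection_toShadow β.1 p)
      rwa [Atiyah.src, Shadow.proj_mk_indexAt] at this
  · intro h p
    rw [h1, h, proj_toShadow]
    rfl

/-! ### Local expressions of automorphisms -/

section LocalExpression

variable {Φ : PrincipaloidAut 𝔓}

/-- The fibre coordinate of the image of a unit under an automorphism. -/
def localExpression (A : TrivializingCover 𝔓 ι) (Φ : PrincipaloidAut 𝔓) (j i : ι) (σ : S)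
    (m : M) : G :=
  (A.triv j (Φ (A.pt i σ (𝒢.unit m)))).2

theorem apply_pt_unit (hi : σ₁ ∈ A.base i) (hj : σ₂ ∈ A.base j)
    (h : ∀ p, 𝔓.proj p = σ₁ → 𝔓.proj (Φ p) = σ₂) (m : M) :
    Φ (A.pt i σ₁ (𝒢.unit m)) = A.pt j σ₂ (A.localExpression Φ j i σ₁ m) := by
  have h1 := h _ (proj_pt hi (𝒢.unit m))
  have h2 := pt_snd (A := A) (i := j) (p := Φ (A.pt i σ₁ (𝒢.unit m))) (by rwa [h1])
  rw [h1] at h2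
  exact h2.symm

theorem src_localExpression (hi : σ₁ ∈ A.base i) (hj : σ₂ ∈ A.base j)
    (h : ∀ p, 𝔓.proj p = σ₁ → 𝔓.proj (Φ p) = σ₂) (m : M) :
    𝒢.src (A.localExpression Φ j i σ₁ m) = m := by
  rw [← moment_pt hj, ← apply_pt_unit hi hj h, Φ.moment_eq, moment_pt hi, 𝒢.src_unit]

/-- Write `τᵢ⁻¹(σ₁, g)` as `τᵢ⁻¹(σ₁, Id_{t(g)})` acted on by `g`: equivariance determines `Φ` on a
fibre from its values on units. -/
theorem apply_pt (hi : σ₁ ∈ A.base i) (hj : σ₂ ∈ A.base j)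
    (h : ∀ p, 𝔓.proj p = σ₁ → 𝔓.proj (Φ p) = σ₂) (g : G) :
    Φ (A.pt i σ₁ g) = A.pt j σ₂ (𝒢.mul (A.localExpression Φ j i σ₁ (𝒢.trg g)) g) := by
  have e := src_localExpression hi hj h (𝒢.trg g)
  rw [← pt_act hj e, ← apply_pt_unit hi hj h, ← Φ.act_eq _ _ (by rw [moment_pt hi, 𝒢.src_unit]),
    pt_act hi (𝒢.src_unit _), 𝒢.unit_mul]

theorem contMDiff_localExpression (hi : σ₁ ∈ A.base i) (hj : σ₂ ∈ A.base j)
    (h : ∀ p, 𝔓.proj p = σ₁ → 𝔓.proj (Φ p) = σ₂) :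
    ContMDiff I J ∞ (A.localExpression Φ j i σ₁) := by
  have h1 : ContMDiff I (IS.prod J) ∞ (fun m => (σ₁, 𝒢.unit m)) :=
    contMDiff_const.prodMk 𝒢.contMDiff_unit
  rw [← contMDiffOn_univ] at h1 ⊢
  refine (A.contMDiffOn_triv_snd j).comp (Φ.toDiffeo.contMDiff.comp_contMDiffOn
    ((A.contMDiffOn_pt i).comp h1 fun _ _ => ⟨hi, trivial⟩)) fun m _ => ?_
  change 𝔓.proj (Φ (A.pt i σ₁ (𝒢.unit m))) ∈ A.base j
  rwa [h _ (proj_pt hi _)]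

/-- Pass to the shadow bundle in `Φ⁻¹(Φ(τᵢ⁻¹(σ₁, Id_m))) = τᵢ⁻¹(σ₁, Id_m)` and compare fibre
coordinates over `σ₁`. -/
theorem trg_localExpression_inv (hi : σ₁ ∈ A.base i) (hj : σ₂ ∈ A.base j)
    (h : ∀ p, 𝔓.proj p = σ₁ → 𝔓.proj (Φ p) = σ₂)
    (h' : ∀ p, 𝔓.proj p = σ₂ → 𝔓.proj (Φ⁻¹ p) = σ₁) (m : M) :
    𝒢.trg (A.localExpression Φ⁻¹ i j σ₂ (𝒢.trg (A.localExpression Φ j i σ₁ m))) = m := by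
  have h1 := congrArg A.toShadow (PrincipaloidAut.inv_apply_self Φ (A.pt i σ₁ (𝒢.unit m)))
  rw [apply_pt_unit hi hj h, apply_pt hj hi h', toShadow_pt hi, toShadow_pt hi,
    𝒢.trg_mul _ _ (src_localExpression hj hi h' _), 𝒢.trg_unit] at h1
  exact (Shadow.mk_inj hi hi h1).2

/-- The local expression of an automorphism at a point of the base is a bisection. -/
def localBisection (A : TrivializingCover 𝔓 ι) (Φ : PrincipaloidAut 𝔓) (hi : σ₁ ∈ A.base i)
    (hj : σ₂ ∈ A.base j) (h : ∀ p, 𝔓.proj p = σ₁ → 𝔓.proj (Φ p) = σ₂)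
    (h' : ∀ p, 𝔓.proj p = σ₂ → 𝔓.proj (Φ⁻¹ p) = σ₁) : Bisection 𝒢 where
  toFun := A.localExpression Φ j i σ₁
  contMDiff_toFun := contMDiff_localExpression hi hj h
  src_toFun := src_localExpression hi hj h
  exists_diffeomorph := ⟨
    { toFun := fun m => 𝒢.trg (A.localExpression Φ j i σ₁ m)
      invFun := fun m => 𝒢.trg (A.localExpression Φ⁻¹ i j σ₂ m)
      left_inv := trg_localExpression_inv hi hj h h'
      right_inv := fun m => by
        simpa using trg_localExpression_inv (Φ := Φ⁻¹) hj hi h' (by simpa using h) m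
      contMDiff_toFun := 𝒢.contMDiff_trg.comp (contMDiff_localExpression hi hj h)
      contMDiff_invFun := 𝒢.contMDiff_trg.comp (contMDiff_localExpression hj hi h') },
    fun _ => rfl⟩

/-- The class is represented by the point with coordinate `Id_m`, for which the quotient in
`division` is by a unit; what remains is the local expression itself. -/
theorem bisectionOfAut_apply_mk (hi : σ₁ ∈ A.base i) (hj : σ₂ ∈ A.base j)
    (h : ∀ p, 𝔓.proj p = σ₁ → 𝔓.proj (Φ p) = σ₂) (m : M) :
    A.bisectionOfAut Φ (Shadow.mk A i σ₁ m) =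
      Atiyah.mk A j σ₂ (A.localExpression Φ j i σ₁ m) σ₁ i := by
  have e := src_localExpression hi hj h m
  have h1 := bisectionOfAut_apply_toShadow (A := A) Φ (A.pt i σ₁ (𝒢.unit m))
  rw [toShadow_pt hi, 𝒢.trg_unit, apply_pt_unit hi hj h,
    division_pt hj hi (by rw [e, 𝒢.src_unit]), 𝒢.inv_unit] at h1
  have h2 := 𝒢.mul_unit (A.localExpression Φ j i σ₁ m)
  rw [e] at h2
  rw [h1, h2]

/-- Here `f` is any map covered by `Φ`. Comparison with the covered diffeomorphism `d`, through a
point `q` over `σ`, supplies the injectivity needed to invert it on fibres. -/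
theorem proj_inv_apply {f : S → S} (hf : ∀ p, 𝔓.proj (Φ p) = f (𝔓.proj p)) {p : P}
    (h : 𝔓.proj p = f σ) : 𝔓.proj (Φ⁻¹ p) = σ := by
  obtain ⟨d, hd⟩ := Φ.exists_base
  obtain ⟨q, rfl⟩ := 𝔓.surjective_proj σ
  refine d.injective ?_
  change d (𝔓.proj (Φ⁻¹ p)) = d (𝔓.proj q)
  rw [← hd, ← hd, hf q, ← h]
  exact congrArg 𝔓.proj (Φ.toDiffeo.apply_symm_apply p)

end LocalExpression

end TrivializingCover

end

end Principaloid

/-! ### The isomorphism, its local formula and its restriction to the gauge group. -/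

theorem mainTheorem9 {EM HM EG HG ES HS EP HP : Type*}
    [NormedAddCommGroup EM] [NormedSpace ℝ EM] [TopologicalSpace HM]
    [NormedAddCommGroup EG] [NormedSpace ℝ EG] [TopologicalSpace HG]
    [NormedAddCommGroup ES] [NormedSpace ℝ ES] [TopologicalSpace HS]
    [NormedAddCommGroup EP] [NormedSpace ℝ EP] [TopologicalSpace HP]
    {I : ModelWithCorners ℝ EM HM} {J : ModelWithCorners ℝ EG HG}
    {IS : ModelWithCorners ℝ ES HS} {IP : ModelWithCorners ℝ EP HP}
    {M G S P : Type*}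
    [TopologicalSpace M] [ChartedSpace HM M] [IsManifold I ∞ M]
    [TopologicalSpace G] [ChartedSpace HG G] [IsManifold J ∞ G]
    [TopologicalSpace S] [ChartedSpace HS S] [IsManifold IS ∞ S]
    [TopologicalSpace P] [ChartedSpace HP P] [IsManifold IP ∞ P]
    (𝒢 : Principaloid.LieGroupoid I J M G)
    (𝔓 : Principaloid.PrincipaloidBundle 𝒢 IP IS P S)
    {ι : Type*} (A : Principaloid.TrivializingCover 𝔓 ι) :
    ∃ Ψ : A.bisecProj ≃* Principaloid.PrincipaloidAut 𝔓,
      (∀ (Φ : Principaloid.PrincipaloidAut 𝔓) (f : S → S),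
        (∀ p, 𝔓.proj (Φ p) = f (𝔓.proj p)) →
        ∀ (i j : ι) (σ : S), σ ∈ A.base i → f σ ∈ A.base j →
          ∃ γ : Principaloid.Bisection 𝒢,
            (∀ g : G, Φ (A.pt i σ g) = A.pt j (f σ) (γ.leftMul g)) ∧
            ∀ m : M, (Ψ.symm Φ).1 (Principaloid.TrivializingCover.Shadow.mk A i σ m) =
              Principaloid.TrivializingCover.Atiyah.mk A j (f σ) (γ m) σ i) ∧
      ∃ Ψ₀ : A.bisecAd ≃* Principaloid.PrincipaloidAut.gauge 𝔓,
        ∀ β : A.bisecAd, (Ψ₀ β : Principaloid.PrincipaloidAut 𝔓) = Ψ (β : A.bisecProj) := by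
  -- The restriction is the isomorphism onto the image of `bisecAd`, followed by the identification
  -- of that image with the gauge group, which is the last goal.
  refine ⟨A.bisecProjEquivAut, fun Φ f hf i j σ hi hj => ?_,
    (A.bisecProjEquivAut.subgroupMap A.bisecAd).trans (MulEquiv.subgroupCongr ?_), fun β => rfl⟩
  · have h : ∀ p, 𝔓.proj p = σ → 𝔓.proj (Φ p) = f σ := fun p hp => by rw [hf, hp]
    have h' : ∀ p, 𝔓.proj p = f σ → 𝔓.proj (Φ⁻¹ p) = σ :=
      fun p hp => Principaloid.TrivializingCover.proj_inv_apply hf hp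
    exact ⟨A.localBisection Φ hi hj h h',
      Principaloid.TrivializingCover.apply_pt hi hj h,
      Principaloid.TrivializingCover.bisectionOfAut_apply_mk hi hj h⟩
  · ext Φ
    -- Writing `Φ` as the image of a bisection turns the equality of subgroups into
    -- `autOfBisection_mem_gauge_iff`.
    rw [← A.bisecProjEquivAut.apply_symm_apply Φ]
    exact (Subgroup.mem_map_equiv).trans ((by rw [MulEquiv.symm_apply_apply]; exact
      (Principaloid.TrivializingCover.autOfBisection_mem_gauge_iff _).symm))
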